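/- Let $\mathbb K$ be a field of characteristic zero. **The algebra $\mathcal A(P)$.** Let $\mathcal A(P)$ be the non-unital $\mathbb K$-algebra freely generated by one element $P$ under two products $\prec,\succ$ that are associative and mutually associative; the words $P\curlywedge_1 P\curlywedge_2\cdots\curlywedge_n P$ ($n\ge 0$, $\curlywedge_i\in\{\prec,\succ\}$) form a basis. Put $\alpha\bullet\beta=\alpha\succ\beta-\alpha\prec\beta$ and $\alpha\,\hat\times\,\beta=-\alpha\prec P\succ\beta$. The main product $\circ$ is the bilinear product for which $v\circ w$, for words $v,w$, is the sum over all shuffles of the letters of $v$ and $w$, where two consecutive letters of a shuffle are joined by $\succ$ if the first is from $v$ and the second from $w$, by $\prec$ if the first is from $w$ and the second from $v$, and by their original symbol otherwise. For $m,n\ge 1$ let $P_n=P^{\bullet n}$; let $U_2=P$ and $U_n=(-1)^nP\prec P^{\circ(n-2)}$ for $n\ge 3$; and let $$C^{(m)}_1=-P_m,\quad C^{(m)}_{n+1}=(-1)^{n+1}P_m\prec P^{\prec n},\qquad H^{(m)}_1=P_m,\quad H^{(m)}_{n+1}=P^{\succ n}\succ P_m .$$ **Pseudo-differential operators.** Let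 $(\mathcal R_0,\ast)$ be a unital associative (not necessarily commutative) $\mathbb K$-algebra with a $\mathbb K$-linear derivation $\partial_x$, let $u_2,u_3,\ldots\in\mathcal R_0$ be arbitrary, and let $L=\partial+\sum_{n\ge1}u_{n+1}\partial^{-n}$ in the algebra of formal pseudo-differential operators $\sum_{k\le N}a_k\partial^k$ over $(\mathcal R_0,\partial_x)$. Write $X_{\ge0}$, $X_{<0}$ for the parts of $X$ with non-negative, respectively negative, powers of $\partial$, and $\mathrm{res}\,X$ for the coefficient of $\partial^{-1}$. Let $\ell$ be the linear map from $\mathcal A(P)$ to operators with $\ell(P)=L$, $\ell(\alpha\prec P)=-\ell(\alpha)_{<0}\ast L$, $\ell(\alpha\succ P)=\ell(\alpha)_{\ge0}\ast L$, and let $\Phi(\alpha)=\mathrm{res}\,\ell(\alpha)$. **Theorem.** 1. $L$ is invertible, and $\Phi(U_n)=u_n$ for all $n\ge2$. 2. For every $m\ge1$ there are unique sequences $(\sigma^{(m)}_n)_{n\ge1}$ and $(\eta^{(m)}_n)_{n\ge1}$ in $\mathcal R_0$ with $$(L^m)_{<0}=-\sum_{n\ge1}\sigma^{(m)}_n\ast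 L^{-n}=\sum_{n\ge1}L^{-n}\ast\eta^{(m)}_n$$ (sums of formal series, coefficientwise), and $\Phi(C^{(m)}_n)=\sigma^{(m)}_n$, $\Phi(H^{(m)}_n)=\eta^{(m)}_n$ for all $n\ge1$. 3. For all $m,n\ge1$ the following identity holds in $\mathcal A(P)$: $$P_m\circ P_n=C^{(n)}_{m+1}+H^{(n)}_{m+1}+\sum_{r=1}^{m-1}\bigl(C^{(n)}_{m-r}\,\hat\times\,P_r+P_r\,\hat\times\,H^{(n)}_{m-r}\bigr).$$ 4. Suppose that $L$ and a potential $\phi\in\mathcal R_0$ solve the ncKP hierarchy with respect to $\mathbb K$-linear derivations $\partial_{t_n}$ ($n\ge1$) of $\mathcal R_0$; that is, $\partial_{t_1}=\partial_x$, every $\partial_{t_n}$ commutes with $\partial_x$, $u_2=\partial_x\phi$, $\partial_{t_n}L=[(L^n)_{\ge0},L]$ and $\partial_{t_n}\phi=\mathrm{res}(L^n)$. Then $\Phi(P_n)=\partial_{t_n}\phi$ and $\Phi(P_m\circ P_n)=\partial_{t_m}\partial_{t_n}\phi$ for all $m,n\ge 1$; for $1\le r\le m-1$ also $\Phi(C^{(n)}_{m-r}\,\hat\times\,P_r)=\sigma^{(n)}_{m-r}\ast\partial_{t_r}\phi$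 and $\Phi(P_r\,\hat\times\,H^{(n)}_{m-r})=\partial_{t_r}\phi\ast\eta^{(n)}_{m-r}$. So $\Phi$ maps the identity in 3, term by term, to $$\partial_{t_m}\partial_{t_n}\phi=\sigma^{(n)}_{m+1}+\eta^{(n)}_{m+1}+\sum_{r=1}^{m-1}\bigl(\sigma^{(n)}_{m-r}\ast\partial_{t_r}\phi+\partial_{t_r}\phi\ast\eta^{(n)}_{m-r}\bigr).$$ 5. The hypotheses of 4 hold for the generic $L$, with coefficients in the free associative differential algebra on $\phi,u_3,u_4,\ldots$ and $u_2=\partial_x\phi$, where $\partial_{t_n}=\delta_n$ is the derivation that commutes with $\partial_x$ and satisfies $\delta_n\phi=\mathrm{res}(L^n)$ and, for $k\ge3$, $\delta_nu_k=$ the coefficient of $\partial^{-(k-1)}$ in $[(L^n)_{\ge0},L]$. -/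

import Mathlib

noncomputable section

namespace NCKP

universe u v

/-! ### Coefficient algebras

A coefficient algebra is an associative (in general noncommutative) unital `K`-algebra `R₀` with
a distinguished derivation `d`, the partial differentiation with respect to `x = t₁`. -/

/-- A `K`-linear derivation of a (noncommutative) `K`-algebra. -/
structure Deriv (K : Type u) (A : Type v) [Field K] [Ring A] [Algebra K A] extends A →ₗ[K] A where
  leibniz' : ∀ a b : A, toFun (a * b) = toFun a * b + a * toFun b

instance {K : Type u} {A : Type v} [Field K] [Ring A] [Algebra K A] :
    CoeFun (Deriv K A) (fun _ => A → A) := ⟨fun d => d.toLinearMap⟩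

variable {K : Type u} {R₀ : Type v} [Field K] [Ring R₀] [Algebra K R₀]

/-! ### Formal pseudo-differential operators -/

/-- Families `(aₖ)`, `k ∈ ℤ`, of coefficients that vanish for all large `k`. -/
def boundedAbove (K : Type u) (R₀ : Type v) [Field K] [Ring R₀] [Algebra K R₀] :
    Submodule K (ℤ → R₀) where
  carrier := {a | ∃ N : ℤ, ∀ k, N < k → a k = 0}
  zero_mem' := ⟨0, fun _ _ => rfl⟩
  add_mem' := by
    rintro a b ⟨M, hM⟩ ⟨N, hN⟩
    refine ⟨max M N, fun k hk => ?_⟩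
    simp [hM k (lt_of_le_of_lt (le_max_left _ _) hk), hN k (lt_of_le_of_lt (le_max_right _ _) hk)]
  smul_mem' := by
    rintro c a ⟨N, hN⟩
    exact ⟨N, fun k hk => by simp [hN k hk]⟩

/-- Formal pseudo-differential operators `∑_{k ≤ N} aₖ ∂ᵏ` over the differential algebra
`(R₀, d)`; an operator is stored as the family of its left coefficients `aₖ`. -/
def PsiDO (_d : Deriv K R₀) : Type v := boundedAbove K R₀

namespace PsiDO

variable {d : Deriv K R₀}

instance : AddCommGroup (PsiDO d) := inferInstanceAs (AddCommGroup (boundedAbove K R₀))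

instance : Module K (PsiDO d) := inferInstanceAs (Module K (boundedAbove K R₀))

/-- The coefficient of `∂ᵏ`. -/
def coeff (X : PsiDO d) (k : ℤ) : R₀ := X.1 k

/-- The composition of operators, determined by the generalized Leibniz rule
`a ∂ⁱ ∘ b ∂ʲ = ∑_{s ≥ 0} (i choose s) a (dˢ b) ∂^(i + j - s)`, `i, j ∈ ℤ`.
For each `k` only finitely many pairs `(i, s)` contribute to the coefficient of `∂ᵏ`. -/
def mulCoeff (X Y : PsiDO d) (k : ℤ) : R₀ :=
  ∑ᶠ p : ℤ × ℕ, Ring.choose p.1 p.2 • (X.coeff p.1 * d^[p.2] (Y.coeff (k - p.1 + p.2)))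

theorem mulCoeff_bounded (X Y : PsiDO d) : mulCoeff X Y ∈ boundedAbove K R₀ := by
  obtain ⟨M, hM⟩ := X.2
  obtain ⟨N, hN⟩ := Y.2
  refine ⟨M + N, fun k hk => ?_⟩
  have h : ∀ p : ℤ × ℕ,
      Ring.choose p.1 p.2 • (X.coeff p.1 * d^[p.2] (Y.coeff (k - p.1 + p.2))) = 0 := by
    rintro ⟨i, s⟩
    by_cases hi : M < i
    · have : X.coeff i = 0 := hM i hi
      simp [this]
    · have : Y.coeff (k - i + s) = 0 := hN _ (by push Not at hi; omega)
      simp only [this]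
      have h0 : d^[s] (0 : R₀) = 0 := Function.iterate_fixed (map_zero d.toLinearMap) s
      simp [h0]
  unfold mulCoeff
  rw [finsum_congr h, finsum_zero]

instance : Mul (PsiDO d) := ⟨fun X Y => ⟨mulCoeff X Y, mulCoeff_bounded X Y⟩⟩

/-- The operator of multiplication by `f ∈ R₀`. -/
def const (f : R₀) : PsiDO d :=
  ⟨fun k => if k = 0 then f else 0, ⟨0, fun k hk => if_neg (by omega)⟩⟩

instance : One (PsiDO d) := ⟨const 1⟩

/-- Powers `Xⁿ`, `n ≥ 0`. -/
def pow (X : PsiDO d) : ℕ → PsiDO d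
  | 0 => 1
  | n + 1 => pow X n * X

/-- `Y` is the two-sided inverse of `X`. -/
def IsInverse (X Y : PsiDO d) : Prop := X * Y = 1 ∧ Y * X = 1

open Classical in
/-- The inverse of an invertible operator (`0` if there is none). -/
def inverse (X : PsiDO d) : PsiDO d := if h : ∃ Y, IsInverse X Y then h.choose else 0

/-- The projection `X ↦ X_{≥ 0}`. -/
def nonnegPart (X : PsiDO d) : PsiDO d :=
  ⟨fun k => if 0 ≤ k then X.coeff k else 0, by
    obtain ⟨N, hN⟩ := X.2
    refine ⟨N, fun k hk => ?_⟩
    have : X.coeff k = 0 := hN k hk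
    simp [this]⟩

/-- The projection `X ↦ X_{< 0}`. -/
def negPart (X : PsiDO d) : PsiDO d :=
  ⟨fun k => if k < 0 then X.coeff k else 0, by
    obtain ⟨N, hN⟩ := X.2
    refine ⟨N, fun k hk => ?_⟩
    have : X.coeff k = 0 := hN k hk
    simp [this]⟩

/-- The residue, i.e. the coefficient of `∂⁻¹`. -/
def res (X : PsiDO d) : R₀ := X.coeff (-1)

/-- The action of a derivation of `R₀` on the coefficients of an operator. -/
def applyDeriv (δ : Deriv K R₀) (X : PsiDO d) : PsiDO d :=
  ⟨fun k => δ (X.coeff k), by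
    obtain ⟨N, hN⟩ := X.2
    refine ⟨N, fun k hk => ?_⟩
    have : X.coeff k = 0 := hN k hk
    simp [this]⟩

/-- `X = ∑_{m ≥ 1} f m`, in the sense of formal series: every coefficient of the partial sums
is eventually constant, with value the corresponding coefficient of `X`. -/
def HasFormalSum (f : ℕ → PsiDO d) (X : PsiDO d) : Prop :=
  ∀ k : ℤ, ∃ N₀ : ℕ, ∀ N ≥ N₀, (∑ m ∈ Finset.Icc 1 N, f m).coeff k = X.coeff k

end PsiDO

open PsiDO

/-- The Lax operator `L = ∂ + ∑_{n ≥ 1} u_{n+1} ∂⁻ⁿ`; only the values `u n` with `n ≥ 2` enter. -/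
def Lax (d : Deriv K R₀) (u : ℕ → R₀) : PsiDO d :=
  ⟨fun k => if k = 1 then 1 else if k < 0 then u ((-k).toNat + 1) else 0,
    ⟨1, fun k hk => by
      have h1 : k ≠ 1 := by omega
      have h2 : ¬ k < 0 := by omega
      simp [h1, h2]⟩⟩

/-- `σ_k`, `k ≥ 1`, are the coefficients `σ⁽ᵐ⁾_k` of `L`:
`(L^m)_{< 0} = - ∑_{k ≥ 1} σ_k L⁻ᵏ`. -/
def IsSigma (d : Deriv K R₀) (u : ℕ → R₀) (m : ℕ) (σ : ℕ → R₀) : Prop :=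
  HasFormalSum (fun k => -(const (σ k) * pow (inverse (Lax d u)) k)) (negPart (pow (Lax d u) m))

/-- `η_k`, `k ≥ 1`, are the coefficients `η⁽ᵐ⁾_k` of `L`:
`(L^m)_{< 0} = ∑_{k ≥ 1} L⁻ᵏ η_k`. -/
def IsEta (d : Deriv K R₀) (u : ℕ → R₀) (m : ℕ) (η : ℕ → R₀) : Prop :=
  HasFormalSum (fun k => pow (inverse (Lax d u)) k * const (η k)) (negPart (pow (Lax d u) m))

/-! ### The algebra generated by one element `P`

`A(P)` is the (non-unital) algebra freely generated by one element `P` under two products `≺` and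
`≻` which are associative and mutually associative.  It has the words `P ⋏₁ P ⋏₂ ⋯ ⋏ₙ P`, each `⋏ᵢ`
being `≺` or `≻`, as a basis.  The product `•` is the difference `≻ - ≺`. -/

/-- The two product symbols `≺` and `≻`. -/
inductive Sep
  | prec
  | succ
  deriving DecidableEq

/-- A basis word `P ⋏₁ P ⋏₂ ⋯ ⋏ₙ P` is given by the list `[⋏₁, …, ⋏ₙ]`; the empty list is `P`. -/
abbrev Word := List Sep

/-- The algebra `A(P)` over `K`, as a vector space. -/
abbrev AP (K : Type u) [Field K] := Word →₀ K

namespace AP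

/-- The generator `P`. -/
def P : AP K := Finsupp.single [] 1

/-- The product `α ≺ β`: juxtaposition of words with `≺` in between. -/
def prec (α β : AP K) : AP K :=
  α.sum fun v x => β.sum fun w y => Finsupp.single (v ++ Sep.prec :: w) (x * y)

/-- The product `α ≻ β`: juxtaposition of words with `≻` in between. -/
def succ (α β : AP K) : AP K :=
  α.sum fun v x => β.sum fun w y => Finsupp.single (v ++ Sep.succ :: w) (x * y)

/-- The product `α • β`, so that `α ≻ β = α ≺ β + α • β`. -/
def bullet (α β : AP K) : AP K := succ α β - prec α β

/-- All shuffles (interleavings preserving both orders) of two lists. -/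
def shuffles {T : Type*} : List T → List T → List (List T)
  | [], ys => [ys]
  | x :: xs, [] => [x :: xs]
  | x :: xs, y :: ys =>
    (shuffles xs (y :: ys)).map (fun l => x :: l) ++ (shuffles (x :: xs) ys).map (fun l => y :: l)

/-- An occurrence of `P` in one of two words that are to be shuffled: `first` tells whether it
belongs to the first word, `sep` is the product symbol which follows it in its word
(irrelevant for the last letter of the word). -/
structure Letter where
  first : Bool
  sep : Sep

/-- The letters of a word. -/
def letters (b : Bool) (w : Word) : List Letter := (w ++ [Sep.prec]).map fun s => ⟨b, s⟩

/-- The product symbol between consecutive letters `a`, `b` of a shuffle: `≻` if `a` is from the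
first and `b` from the second word, `≺` if `a` is from the second and `b` from the first word, and
the original symbol if both are from the same word. -/
def joint (a b : Letter) : Sep :=
  if a.first = true ∧ b.first = false then Sep.succ
  else if a.first = false ∧ b.first = true then Sep.prec
  else a.sep

/-- The word belonging to a shuffle. -/
def toWord : List Letter → Word
  | [] => []
  | [_] => []
  | a :: b :: l => joint a b :: toWord (b :: l)

/-- The main product `v ∘ w` of two basis words: the sum over all shuffles. -/
def circWord (v w : Word) : AP K :=
  ((shuffles (letters true v) (letters false w)).map fun l => Finsupp.single (toWord l) 1).sum

/-- The main product `α ∘ β`, the bilinear extension of the (mixable) shuffle product of words. -/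
def circ (α β : AP K) : AP K :=
  α.sum fun v x => β.sum fun w y => (x * y) • circWord v w

/-- The product `α ×̂ β = - α ≺ P ≻ β`. -/
def hcross (α β : AP K) : AP K := -succ (prec α P) β

/-- Powers `αⁿ`, `n ≥ 1`, with respect to an associative product (`A(P)` has no unit; the
value at `n = 0` is a dummy). -/
def opPow (op : AP K → AP K → AP K) (α : AP K) : ℕ → AP K
  | 0 => 0
  | 1 => α
  | n + 2 => op (opPow op α (n + 1)) α

/-- `P_n = P^{• n}`, `n ≥ 1`. -/
def Pn (n : ℕ) : AP K := opPow bullet P n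

/-- `U_2 = P` and `U_n = (-1)ⁿ P ≺ P^{∘ (n-2)}` for `n ≥ 3`. -/
def U (n : ℕ) : AP K := if n = 2 then P else (-1 : K) ^ n • prec P (opPow circ P (n - 2))

/-- `C⁽ᵐ⁾_1 = - P_m` and `C⁽ᵐ⁾_{n+1} = (-1)^{n+1} P_m ≺ P^{≺ n}` for `n ≥ 1`. -/
def C (m n : ℕ) : AP K := if n = 1 then -Pn m else (-1 : K) ^ n • prec (Pn m) (opPow prec P (n - 1))

/-- `H⁽ᵐ⁾_1 = P_m` and `H⁽ᵐ⁾_{n+1} = P^{≻ n} ≻ P_m` for `n ≥ 1`. -/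
def H (m n : ℕ) : AP K := if n = 1 then Pn m else succ (opPow succ P (n - 1)) (Pn m)

end AP

open AP

/-! ### The maps `ℓ` and `Φ` -/

/-- One step in the definition of `ℓ`: from `ℓ(α)` to `ℓ(α ≺ P) = - ℓ(α)_{< 0} L`, respectively
`ℓ(α ≻ P) = ℓ(α)_{≥ 0} L`. -/
def ellStep (d : Deriv K R₀) (u : ℕ → R₀) (X : PsiDO d) : Sep → PsiDO d
  | Sep.prec => -negPart X * Lax d u
  | Sep.succ => nonnegPart X * Lax d u

/-- The linear map `ℓ` from `A(P)` to operators: `ℓ(P) = L`, `ℓ(α ≺ P) = - ℓ(α)_{< 0} L`,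
`ℓ(α ≻ P) = ℓ(α)_{≥ 0} L`. -/
def ell (d : Deriv K R₀) (u : ℕ → R₀) : AP K →ₗ[K] PsiDO d :=
  Finsupp.linearCombination K fun w : Word => w.foldl (ellStep d u) (Lax d u)

/-- `Φ(α) = res ℓ(α)`. -/
def Phi (d : Deriv K R₀) (u : ℕ → R₀) (α : AP K) : R₀ := res (ell d u α)

/-! ### The noncommutative KP hierarchy -/

/-- `(u, φ)` solves the ncKP hierarchy, with `dt n` in the role of `∂_{t_n}`, `n ≥ 1`, and with `φ`
the potential of `u`. -/
structure IsNcKP (d : Deriv K R₀) (u : ℕ → R₀) (φ : R₀) (dt : ℕ → Deriv K R₀) : Prop where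
  /-- `x = t_1` -/
  dt_one : ∀ a, dt 1 a = d a
  /-- `∂_{t_n}` and `∂_x` commute -/
  dt_comm : ∀ n ≥ 1, ∀ a, dt n (d a) = d (dt n a)
  /-- the Lax equations `L_{t_n} = [(L^n)_{≥ 0}, L]` -/
  lax : ∀ n ≥ 1, applyDeriv (dt n) (Lax d u) =
    nonnegPart (pow (Lax d u) n) * Lax d u - Lax d u * nonnegPart (pow (Lax d u) n)
  /-- `u_2 = φ_x` -/
  potential : u 2 = d φ
  /-- `φ_{t_n} = res (L^n)`: the `x`-integral of the equation for `u_2` contained in `lax` -/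
  potential_flow : ∀ n ≥ 1, dt n φ = res (pow (Lax d u) n)

/-! ### The generic solution

The free differential algebra on `φ, u_3, u_4, …`: the free associative algebra on the symbols
`(0, j) = ∂_xʲ φ` and `(i + 1, j) = ∂_xʲ u_{i+3}`.  With `u_2 = φ_x` it contains the free
differential algebra on `u_2, u_3, u_4, …`. -/

/-- The derivation of a free algebra with prescribed values on the generators: `a ↦ a + ε f(a)`
extends to an algebra homomorphism into the algebra of dual numbers. -/
def freeDeriv {T : Type*} (f : T → FreeAlgebra K T) : Deriv K (FreeAlgebra K T) :=
  let F : FreeAlgebra K T →ₐ[K] TrivSqZeroExt (FreeAlgebra K T) (FreeAlgebra K T) :=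
    FreeAlgebra.lift K fun t => TrivSqZeroExt.inl (FreeAlgebra.ι K t) + TrivSqZeroExt.inr (f t)
  { toFun := fun a => (F a).snd
    map_add' := fun a b => by simp
    map_smul' := fun c a => by simp
    leibniz' := fun a b => by
      have h : ∀ a, (F a).fst = a := fun a => by
        have : (TrivSqZeroExt.fstHom K (FreeAlgebra K T) (FreeAlgebra K T)).comp F =
            AlgHom.id K _ := by
          ext t
          simp [F]
        exact DFunLike.congr_fun this a
      simp [h, add_comm] }

/-- The differentiation `∂_x` of the free differential algebra. -/
def genD (K : Type u) [Field K] : Deriv K (FreeAlgebra K (ℕ × ℕ)) :=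
  freeDeriv fun p => FreeAlgebra.ι K (p.1, p.2 + 1)

/-- The generic potential `φ`. -/
def genPhi (K : Type u) [Field K] : FreeAlgebra K (ℕ × ℕ) := FreeAlgebra.ι K (0, 0)

/-- The generic coefficients: `u_2 = φ_x`, and `u_n` is a free generator for `n ≥ 3`. -/
def genU (K : Type u) [Field K] (n : ℕ) : FreeAlgebra K (ℕ × ℕ) :=
  if n = 2 then genD K (genPhi K) else FreeAlgebra.ι K (n - 2, 0)

/-- The flow `δ_n`: the derivation commuting with `∂_x` such that `δ_n φ = res (L^n)` and
`δ_n u_{i+2}`, `i ≥ 1`, is the coefficient of `∂^{-(i+1)}` in `[(L^n)_{≥ 0}, L]`. -/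
def genFlow (K : Type u) [Field K] (n : ℕ) : Deriv K (FreeAlgebra K (ℕ × ℕ)) :=
  let L := Lax (genD K) (genU K)
  freeDeriv fun p => (genD K)^[p.2] <|
    if p.1 = 0 then res (pow L n)
    else (nonnegPart (pow L n) * L - L * nonnegPart (pow L n)).coeff (-(p.1 + 1 : ℤ))

end NCKP

end

open NCKP

noncomputable section

namespace NCKP

universe u v

section

/-! ### The ring of pseudo-differential operators -/

variable {K : Type u} {R₀ : Type v} [Field K] [Ring R₀] [Algebra K R₀]

/-! Everything is driven by what the products do to `ℓ`. Words are read from the left, so `ℓ(α ≺ β)`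
and `ℓ(α ≻ β)` are the recursion of `ℓ` along `β`, started at `-ℓ(α)_{<0} L` or `ℓ(α)_{≥0} L`
(`ellFrom_op`). The two starts differ by `ℓ(α) L`, hence `ℓ(P_n) = L^n`. Since `ℓ(α)_{<0} L` has
order at most zero, its differential part is multiplication by the residue of `ℓ(α)`, which makes
`Φ` multiplicative for `×̂` (`Phi_hcross`).

An operator of negative order expands in powers of `L⁻¹` by repeatedly splitting off its residue,
multiplying by `L` and taking the negative part. The elements `C` and `H` perform this division on
the right and on the left (`isSigma_Phi_C`, `isEta_Phi_H`).

In `A(P)`, sorting shuffles by their last letter gives recursions whose mixed terms cancel for `•`.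
Thus `P_m ∘ P_n = P_n ≺ P_m + P_m ≻ P_n` (`circ_Pn_Pn`), and peeling off one `P` at a time turns the
two summands into the `C` and `H` terms (`prec_C_Pn`, `succ_Pn_H`).

The link with the flows is `Φ(α ∘ P_n) = ∂_{t_n} Φ(α)` (`Phi_circ_Pn`). It is proved for an
arbitrary initial operator `-Y L`, with an explicit correction that vanishes at `Y = -1`. The same
formula with `n = 1` and `Y` of negative order computes `Φ(U_n)` (`res_ellFrom_circ_pow`). For the
generic `L`, the only Lax coefficients that do not hold by definition are those of `∂⁻¹` and of the
non-negative powers; they follow from `[(L^n)_{≥0}, L] = [L, (L^n)_{<0}]`. -/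

theorem Deriv.map_mul (δ : Deriv K R₀) (a b : R₀) : δ (a * b) = δ a * b + a * δ b :=
  δ.leibniz' a b

theorem Deriv.map_one (δ : Deriv K R₀) : δ (1 : R₀) = 0 := by
  have h := δ.map_mul 1 1
  simpa using h

namespace PsiDO

variable {d : Deriv K R₀}

@[ext] theorem ext {X Y : PsiDO d} (h : ∀ k, X.coeff k = Y.coeff k) : X = Y :=
  Subtype.ext (funext h)

@[simp] theorem coeff_zero (k : ℤ) : (0 : PsiDO d).coeff k = 0 := rfl

@[simp] theorem coeff_add (X Y : PsiDO d) (k : ℤ) : (X + Y).coeff k = X.coeff k + Y.coeff k := rfl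

@[simp] theorem coeff_neg (X : PsiDO d) (k : ℤ) : (-X).coeff k = -X.coeff k := rfl

@[simp] theorem coeff_sub (X Y : PsiDO d) (k : ℤ) : (X - Y).coeff k = X.coeff k - Y.coeff k := rfl

@[simp] theorem coeff_smul (c : K) (X : PsiDO d) (k : ℤ) : (c • X).coeff k = c • X.coeff k := rfl

/-- The coefficient of `∂ᵏ` as an additive map. -/
def coeffHom (d : Deriv K R₀) (k : ℤ) : PsiDO d →+ R₀ where
  toFun X := X.coeff k
  map_zero' := rfl
  map_add' _ _ := rfl

@[simp] theorem coeff_sum {ι : Type*} (s : Finset ι) (f : ι → PsiDO d) (k : ℤ) :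
    (∑ i ∈ s, f i).coeff k = ∑ i ∈ s, (f i).coeff k :=
  map_sum (coeffHom d k) f s

/-- `X` has order at most `N`. -/
def OrdLE (X : PsiDO d) (N : ℤ) : Prop := ∀ k, N < k → X.coeff k = 0

theorem exists_ordLE (X : PsiDO d) : ∃ N, OrdLE X N := X.2

theorem OrdLE.mono {X : PsiDO d} {M N : ℤ} (h : OrdLE X M) (hMN : M ≤ N) : OrdLE X N :=
  fun k hk => h k (by omega)

theorem OrdLE.add {X Y : PsiDO d} {N : ℤ} (hX : OrdLE X N) (hY : OrdLE Y N) :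
    OrdLE (X + Y) N := fun k hk => by simp [hX k hk, hY k hk]

theorem OrdLE.neg {X : PsiDO d} {N : ℤ} (hX : OrdLE X N) : OrdLE (-X) N :=
  fun k hk => by simp [hX k hk]

theorem iterate_zero_apply (s : ℕ) : d^[s] (0 : R₀) = 0 :=
  Function.iterate_fixed (map_zero d.toLinearMap) s

theorem iterate_add_apply (s : ℕ) (a b : R₀) : d^[s] (a + b) = d^[s] a + d^[s] b := by
  induction s generalizing a b with
  | zero => rfl
  | succ s ih => simp

theorem iterate_smul_apply (s : ℕ) (c : K) (a : R₀) : d^[s] (c • a) = c • d^[s] a := by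
  induction s generalizing a with
  | zero => rfl
  | succ s ih => simp [ih]

theorem coeff_mul (X Y : PsiDO d) (k : ℤ) : (X * Y).coeff k =
    ∑ᶠ p : ℤ × ℕ, Ring.choose p.1 p.2 • (X.coeff p.1 * d^[p.2] (Y.coeff (k - p.1 + p.2))) := rfl

theorem coeff_mul_eq_sum {X Y : PsiDO d} {M N : ℤ} (hX : OrdLE X M) (hY : OrdLE Y N) {k : ℤ}
    {S : Finset (ℤ × ℕ)} (hS : ∀ p : ℤ × ℕ, p.1 ≤ M → k - p.1 + p.2 ≤ N → p ∈ S) :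
    (X * Y).coeff k =
      ∑ p ∈ S, Ring.choose p.1 p.2 • (X.coeff p.1 * d^[p.2] (Y.coeff (k - p.1 + p.2))) := by
  rw [coeff_mul]
  refine finsum_eq_sum_of_support_subset _ fun p hp => ?_
  by_contra hpS
  apply hp
  beta_reduce
  by_cases h : p.1 ≤ M
  · rw [hY (k - p.1 + p.2) (by
      by_contra h'
      exact hpS (hS p h (by omega))), iterate_zero_apply, mul_zero, smul_zero]
  · rw [hX p.1 (by omega), zero_mul, smul_zero]

theorem exists_box (M N k : ℤ) :
    ∃ S : Finset (ℤ × ℕ), ∀ p : ℤ × ℕ, p.1 ≤ M → k - p.1 + p.2 ≤ N → p ∈ S :=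
  ⟨Finset.Icc (k - N) M ×ˢ Finset.range ((M + N - k).toNat + 1), fun p h1 h2 => by
    simp only [Finset.mem_product, Finset.mem_Icc, Finset.mem_range]
    omega⟩

theorem OrdLE.mul {X Y : PsiDO d} {M N : ℤ} (hX : OrdLE X M) (hY : OrdLE Y N) :
    OrdLE (X * Y) (M + N) := fun k hk => by
  rw [coeff_mul_eq_sum hX hY (S := ∅) (fun p h1 h2 => by omega), Finset.sum_empty]

instance : NonUnitalNonAssocRing (PsiDO d) where
  left_distrib X Y Z := by
    ext k
    obtain ⟨M, hM⟩ := exists_ordLE X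
    obtain ⟨N₁, h₁⟩ := exists_ordLE Y
    obtain ⟨N₂, h₂⟩ := exists_ordLE Z
    replace h₁ := h₁.mono (le_max_left N₁ N₂)
    replace h₂ := h₂.mono (le_max_right N₁ N₂)
    obtain ⟨S, hS⟩ := exists_box M (max N₁ N₂) k
    rw [coeff_add, coeff_mul_eq_sum hM h₁ hS, coeff_mul_eq_sum hM h₂ hS,
      coeff_mul_eq_sum hM (h₁.add h₂) hS, ← Finset.sum_add_distrib]
    refine Finset.sum_congr rfl fun p _ => ?_
    rw [coeff_add, iterate_add_apply, mul_add, smul_add]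
  right_distrib X Y Z := by
    ext k
    obtain ⟨M, hM⟩ := exists_ordLE Z
    obtain ⟨N₁, h₁⟩ := exists_ordLE X
    obtain ⟨N₂, h₂⟩ := exists_ordLE Y
    replace h₁ := h₁.mono (le_max_left N₁ N₂)
    replace h₂ := h₂.mono (le_max_right N₁ N₂)
    obtain ⟨S, hS⟩ := exists_box (max N₁ N₂) M k
    rw [coeff_add, coeff_mul_eq_sum h₁ hM hS, coeff_mul_eq_sum h₂ hM hS,
      coeff_mul_eq_sum (h₁.add h₂) hM hS, ← Finset.sum_add_distrib]
    refine Finset.sum_congr rfl fun p _ => ?_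
    rw [coeff_add, add_mul, smul_add]
  zero_mul X := by
    ext k
    rw [coeff_mul]
    simp
  mul_zero X := by
    ext k
    rw [coeff_mul]
    simp

theorem smul_mul_assoc' (c : K) (X Y : PsiDO d) : c • X * Y = c • (X * Y) := by
  ext k
  obtain ⟨M, hM⟩ := exists_ordLE X
  obtain ⟨N, hN⟩ := exists_ordLE Y
  obtain ⟨S, hS⟩ := exists_box M N k
  have hc : OrdLE (c • X) M := fun k hk => by rw [coeff_smul, hM k hk, smul_zero]
  rw [coeff_smul, coeff_mul_eq_sum hM hN hS, coeff_mul_eq_sum hc hN hS, Finset.smul_sum]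
  refine Finset.sum_congr rfl fun p _ => ?_
  rw [coeff_smul, smul_mul_assoc, smul_comm]

theorem mul_smul_comm' (c : K) (X Y : PsiDO d) : X * c • Y = c • (X * Y) := by
  ext k
  obtain ⟨M, hM⟩ := exists_ordLE X
  obtain ⟨N, hN⟩ := exists_ordLE Y
  obtain ⟨S, hS⟩ := exists_box M N k
  have hc : OrdLE (c • Y) N := fun k hk => by rw [coeff_smul, hN k hk, smul_zero]
  rw [coeff_smul, coeff_mul_eq_sum hM hN hS, coeff_mul_eq_sum hM hc hS, Finset.smul_sum]
  refine Finset.sum_congr rfl fun p _ => ?_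
  rw [coeff_smul, iterate_smul_apply, mul_smul_comm, smul_comm]

/-- The operator `a ∂ⁱ`. -/
def monomial (d : Deriv K R₀) (a : R₀) (i : ℤ) : PsiDO d :=
  ⟨fun k => if k = i then a else 0, ⟨i, fun k hk => if_neg (by omega)⟩⟩

theorem coeff_monomial (a : R₀) (i k : ℤ) :
    (monomial d a i).coeff k = if k = i then a else 0 := rfl

theorem const_eq_monomial (a : R₀) : (const a : PsiDO d) = monomial d a 0 := rfl

theorem coeff_const (a : R₀) (k : ℤ) : (const a : PsiDO d).coeff k = if k = 0 then a else 0 := rfl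

theorem coeff_one (k : ℤ) : (1 : PsiDO d).coeff k = if k = 0 then 1 else 0 := rfl

theorem ordLE_monomial (a : R₀) (i : ℤ) : OrdLE (monomial d a i) i :=
  fun k hk => if_neg (by omega)

theorem coeff_monomial_mul (a : R₀) (i : ℤ) {Y : PsiDO d} {N : ℤ} (hY : OrdLE Y N) {k : ℤ} {T : ℕ}
    (hT : N - k + i < T) : (monomial d a i * Y).coeff k =
      ∑ s ∈ Finset.range T, Ring.choose i s • (a * d^[s] (Y.coeff (k - i + s))) := by
  rw [coeff_mul]
  rw [finsum_eq_sum_of_support_subset (s := ({i} : Finset ℤ) ×ˢ Finset.range T)]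
  · rw [Finset.sum_product, Finset.sum_singleton]
    simp [coeff_monomial]
  · rintro ⟨j, s⟩ hp
    simp only [Finset.coe_product, Set.mem_prod, Finset.coe_singleton, Set.mem_singleton_iff,
      Finset.coe_range, Set.mem_Iio]
    simp only [Function.mem_support] at hp
    by_cases hj : j = i
    · refine ⟨hj, ?_⟩
      by_contra hs
      apply hp
      rw [hY _ (by subst hj; omega), iterate_zero_apply, mul_zero, smul_zero]
    · rw [coeff_monomial, if_neg hj, zero_mul, smul_zero] at hp
      exact absurd rfl hp

theorem coeff_const_mul (a : R₀) (Y : PsiDO d) (k : ℤ) :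
    (const a * Y).coeff k = a * Y.coeff k := by
  obtain ⟨N, hN⟩ := exists_ordLE Y
  rw [const_eq_monomial, coeff_monomial_mul a 0 hN (T := (N - k).toNat + 1) (by omega),
    Finset.sum_range_succ', Finset.sum_eq_zero, zero_add]
  · simp
  · intro s _
    rw [Ring.choose_zero_succ, zero_smul]

theorem monomial_mul (a : R₀) (i : ℤ) (Y : PsiDO d) :
    monomial d a i * Y = const a * (monomial d 1 i * Y) := by
  ext k
  obtain ⟨N, hN⟩ := exists_ordLE Y
  have hT : N - k + i < ((N - k + i).toNat + 1 : ℕ) := by omega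
  rw [coeff_const_mul, coeff_monomial_mul a i hN hT, coeff_monomial_mul 1 i hN hT, Finset.mul_sum]
  refine Finset.sum_congr rfl fun s _ => ?_
  rw [one_mul, mul_smul_comm]

/-- The operator `∂`. -/
def partialOp (d : Deriv K R₀) : PsiDO d := monomial d 1 1

theorem coeff_partialOp_mul (Y : PsiDO d) (k : ℤ) :
    (partialOp d * Y).coeff k = Y.coeff (k - 1) + d (Y.coeff k) := by
  obtain ⟨N, hN⟩ := exists_ordLE Y
  rw [partialOp, coeff_monomial_mul 1 1 hN (T := (N - k).toNat + 2) (by omega),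
    Finset.sum_range_succ', Finset.sum_range_succ', Finset.sum_eq_zero]
  · simp
    abel
  · intro s _
    have : Ring.choose (1 : ℤ) (s + 1 + 1) = 0 := by
      have := Ring.choose_natCast (R := ℤ) 1 (s + 1 + 1)
      simpa [Nat.choose_eq_zero_of_lt] using this
    rw [this, zero_smul]

/-- This is Pascal's rule for `Ring.choose`, which holds for negative `i` as well. -/
theorem partialOp_mul_monomial_one_mul (i : ℤ) (Z : PsiDO d) :
    partialOp d * (monomial d 1 i * Z) = monomial d 1 (i + 1) * Z := by
  ext k
  obtain ⟨N, hN⟩ := exists_ordLE Z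
  obtain ⟨T, hT⟩ : ∃ T : ℕ, N - k + i < T := ⟨(N - k + i).toNat + 1, by omega⟩
  rw [coeff_partialOp_mul, coeff_monomial_mul 1 i hN (k := k - 1) (T := T + 1) (by push_cast; omega),
    coeff_monomial_mul 1 i hN hT,
    coeff_monomial_mul 1 (i + 1) hN (k := k) (T := T + 1) (by push_cast; omega),
    Finset.sum_range_succ', Finset.sum_range_succ' (n := T), map_sum]
  rw [add_right_comm, ← Finset.sum_add_distrib]
  congr 1
  · refine Finset.sum_congr rfl fun s _ => ?_
    rw [Ring.choose_succ_succ, add_smul, one_mul, one_mul, one_mul, map_zsmul, add_comm]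
    have h1 : k - 1 - i + ((s + 1 : ℕ) : ℤ) = k - i + s := by push_cast; ring
    have h2 : k - (i + 1) + ((s + 1 : ℕ) : ℤ) = k - i + s := by push_cast; ring
    rw [h1, h2, Function.iterate_succ_apply']
  · have h1 : k - 1 - i + ((0 : ℕ) : ℤ) = k - (i + 1) + ((0 : ℕ) : ℤ) := by push_cast; ring
    rw [h1, Ring.choose_zero_right, Ring.choose_zero_right]

theorem partialOp_mul_const_mul (b : R₀) (W : PsiDO d) :
    partialOp d * (const b * W) = const b * (partialOp d * W) + const (d b) * W := by
  ext k
  simp only [coeff_partialOp_mul, coeff_const_mul, coeff_add, d.map_mul, mul_add]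
  abel

theorem partialOp_mul_monomial (b : R₀) (j : ℤ) :
    partialOp d * monomial d b j = monomial d b (j + 1) + monomial d (d b) j := by
  ext k
  simp only [coeff_partialOp_mul, coeff_monomial, coeff_add, sub_eq_iff_eq_add]
  split_ifs <;> simp

theorem const_mul_monomial (a b : R₀) (j : ℤ) :
    const a * monomial d b j = monomial d (a * b) j := by
  ext k
  simp only [coeff_const_mul, coeff_monomial, mul_ite, mul_zero]

theorem const_mul_const_mul (a b : R₀) (W : PsiDO d) :
    const a * (const b * W) = const (a * b) * W := by
  ext k
  simp only [coeff_const_mul, mul_assoc]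

theorem partialOp_mul_injective {W W' : PsiDO d} (h : partialOp d * W = partialOp d * W') :
    W = W' := by
  rw [← sub_eq_zero] at h ⊢
  rw [← mul_sub] at h
  generalize W - W' = V at h ⊢
  obtain ⟨N, hN⟩ := exists_ordLE V
  -- The coefficient of `∂^(k+1)` in `∂ V` is `V_k + d V_{k+1}`, so the vanishing of the
  -- coefficients of `V` propagates downwards.
  have key : ∀ n : ℕ, OrdLE V (N - n) := by
    intro n
    induction n with
    | zero => simpa using hN
    | succ n ih =>
      intro k hk
      by_cases hk' : N - n < k
      · exact ih k hk'
      · have h1 := congrArg (fun X => X.coeff (k + 1)) h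
        simp only [coeff_partialOp_mul, coeff_zero, add_sub_cancel_right] at h1
        rwa [ih (k + 1) (by push_cast at hk; omega), map_zero, add_zero] at h1
  ext k
  exact key ((N - k).toNat + 1) k (by push_cast; omega)

/-- Additive maps that respect the filtration by the order are determined by their values on
monomials. -/
theorem eq_of_forall_monomial {f g : PsiDO d →+ PsiDO d} {s : ℤ}
    (hf : ∀ X N, OrdLE X N → OrdLE (f X) (N + s)) (hg : ∀ X N, OrdLE X N → OrdLE (g X) (N + s))
    (h : ∀ a i, f (monomial d a i) = g (monomial d a i)) (X : PsiDO d) : f X = g X := by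
  ext k
  obtain ⟨M, hM⟩ := exists_ordLE X
  set X' : PsiDO d := ∑ i ∈ Finset.Icc (k - s) M, monomial d (X.coeff i) i with hX'
  -- Both maps raise the order by at most `s`, so this remainder contributes nothing to the
  -- coefficient of `∂ᵏ`, and only a finite sum of monomials is left.
  have hr : OrdLE (X - X') (k - s - 1) := by
    intro j hj
    simp only [hX', coeff_sub, coeff_sum, coeff_monomial, Finset.sum_ite_eq, Finset.mem_Icc]
    split_ifs with hjM
    · exact sub_self _
    · rw [hM j (by omega), sub_zero]
  have h1 : f X' = g X' := by rw [hX', map_sum, map_sum]; simp only [h]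
  have h2 : X = X' + (X - X') := by abel
  rw [h2, map_add, map_add, coeff_add, coeff_add, h1, hf _ _ hr k (by omega), hg _ _ hr k (by omega)]

/-- Both sides are additive in the middle factor and respect the order filtration, so associativity
is needed only for monomials in the middle. -/
theorem mul_assoc_of_forall_monomial {X Z : PsiDO d}
    (h : ∀ b j, X * monomial d b j * Z = X * (monomial d b j * Z)) (Y : PsiDO d) :
    X * Y * Z = X * (Y * Z) := by
  obtain ⟨M, hM⟩ := exists_ordLE X
  obtain ⟨N, hN⟩ := exists_ordLE Z
  exact eq_of_forall_monomial
    (f := (AddMonoidHom.mulRight Z).comp (AddMonoidHom.mulLeft X))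
    (g := (AddMonoidHom.mulLeft X).comp (AddMonoidHom.mulRight Z)) (s := M + N)
    (fun Y B hB => ((hM.mul hB).mul hN).mono (by omega))
    (fun Y B hB => (hM.mul (hB.mul hN)).mono (by omega)) h Y

theorem const_mul_assoc (a : R₀) (Y Z : PsiDO d) : const a * Y * Z = const a * (Y * Z) :=
  mul_assoc_of_forall_monomial (fun b j => by
    rw [const_mul_monomial, monomial_mul, monomial_mul b, const_mul_const_mul]) Y

theorem partialOp_mul_assoc (Y Z : PsiDO d) : partialOp d * Y * Z = partialOp d * (Y * Z) :=
  mul_assoc_of_forall_monomial (fun b j => by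
    rw [partialOp_mul_monomial, add_mul, monomial_mul b j, partialOp_mul_const_mul,
      partialOp_mul_monomial_one_mul, monomial_mul b, monomial_mul (d b)]) Y

/-- Positive powers follow from associativity for `∂`. For negative powers, multiplication by `∂` on
the left raises the exponent and can be cancelled because it is injective. -/
theorem monomial_one_mul_assoc (i : ℤ) (Y Z : PsiDO d) :
    monomial d 1 i * Y * Z = monomial d 1 i * (Y * Z) := by
  induction i using Int.induction_on with
  | zero => exact const_mul_assoc 1 Y Z
  | succ i ih =>
    rw [← partialOp_mul_monomial_one_mul, partialOp_mul_assoc, ih, partialOp_mul_monomial_one_mul]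
  | pred i ih =>
    apply partialOp_mul_injective
    rw [← partialOp_mul_assoc, partialOp_mul_monomial_one_mul, partialOp_mul_monomial_one_mul,
      sub_add_cancel, ih]

instance : Ring (PsiDO d) where
  mul_assoc X Y Z := by
    obtain ⟨M, hM⟩ := exists_ordLE Y
    obtain ⟨N, hN⟩ := exists_ordLE Z
    exact eq_of_forall_monomial
      (f := (AddMonoidHom.mulRight Z).comp (AddMonoidHom.mulRight Y))
      (g := AddMonoidHom.mulRight (Y * Z)) (s := M + N)
      (fun X B hB => ((hB.mul hM).mul hN).mono (by omega))
      (fun X B hB => hB.mul (hM.mul hN))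
      (fun a i => by
        simp only [AddMonoidHom.comp_apply, AddMonoidHom.mulRight_apply]
        rw [monomial_mul, const_mul_assoc, monomial_one_mul_assoc, ← monomial_mul]) X
  one_mul X := by
    ext k
    exact (coeff_const_mul 1 X k).trans (one_mul _)
  mul_one X := eq_of_forall_monomial
      (f := AddMonoidHom.mulRight 1) (g := AddMonoidHom.id _) (s := 0)
      (fun X B hB => hB.mul (ordLE_monomial 1 0)) (fun X B hB => hB.mono (by omega))
      (fun a i => by
        simp only [AddMonoidHom.id_apply, AddMonoidHom.mulRight_apply]
        ext k
        have h1 : OrdLE (1 : PsiDO d) 0 := ordLE_monomial 1 0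
        obtain ⟨T, hT⟩ : ∃ T : ℕ, 0 - k + i < T := ⟨(0 - k + i).toNat + 1, by omega⟩
        rw [coeff_monomial_mul a i h1 (hT.trans (Nat.cast_lt.2 (Nat.lt_succ_self T))),
          Finset.sum_range_succ', Finset.sum_eq_zero]
        · simp [coeff_one, coeff_monomial, sub_eq_zero]
        · intro s _
          rw [coeff_one, Function.iterate_succ_apply, apply_ite d, d.map_one]
          simp) X
  neg_add_cancel := neg_add_cancel
  zsmul := fun n X => n • X
  zsmul_zero' := SubNegMonoid.zsmul_zero'
  zsmul_succ' := SubNegMonoid.zsmul_succ'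
  zsmul_neg' := SubNegMonoid.zsmul_neg'
  sub_eq_add_neg := sub_eq_add_neg

instance : IsScalarTower K (PsiDO d) (PsiDO d) := ⟨smul_mul_assoc'⟩

instance : SMulCommClass K (PsiDO d) (PsiDO d) := ⟨fun c X Y => (mul_smul_comm' c X Y).symm⟩

theorem pow_eq (X : PsiDO d) (n : ℕ) : pow X n = X ^ n := by
  induction n with
  | zero => exact (pow_zero X).symm
  | succ n ih => rw [pow_succ, ← ih]; rfl

end PsiDO

end

section

variable {K : Type u} {R₀ : Type v} [Field K] [Ring R₀] [Algebra K R₀]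

namespace PsiDO

variable {d : Deriv K R₀}

/-! ### Order estimates and leading coefficients -/

theorem OrdLE.sub {X Y : PsiDO d} {N : ℤ} (hX : OrdLE X N) (hY : OrdLE Y N) :
    OrdLE (X - Y) N := sub_eq_add_neg X Y ▸ hX.add hY.neg

theorem OrdLE.pow {X : PsiDO d} {M : ℤ} (hX : OrdLE X M) (n : ℕ) : OrdLE (X ^ n) (n * M) := by
  induction n with
  | zero =>
    rw [pow_zero, Nat.cast_zero, zero_mul]
    exact ordLE_monomial 1 0
  | succ n ih =>
    rw [pow_succ]
    exact (ih.mul hX).mono (by push_cast; linarith)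

theorem eq_of_forall_ordLE_sub {X Y : PsiDO d} (h : ∀ n : ℕ, OrdLE (X - Y) (-n)) : X = Y := by
  ext k
  exact sub_eq_zero.1 (h ((-k).toNat + 1) k (by push_cast; omega))

theorem coeff_mul_top {X Y : PsiDO d} {M N : ℤ} (hX : OrdLE X M) (hY : OrdLE Y N) :
    (X * Y).coeff (M + N) = X.coeff M * Y.coeff N := by
  rw [coeff_mul_eq_sum hX hY (S := {(M, 0)}) (fun p h1 h2 => by
    rw [Finset.mem_singleton]
    exact Prod.ext (by omega) (by simp only; omega)), Finset.sum_singleton]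
  simp

theorem coeff_mul_partialOp (X : PsiDO d) (k : ℤ) : (X * partialOp d).coeff k = X.coeff (k - 1) := by
  rw [coeff_mul, finsum_eq_single _ (k - 1, 0)]
  · simp [partialOp, coeff_monomial]
  · rintro ⟨i, s⟩ hp
    dsimp only
    rw [partialOp, coeff_monomial]
    split_ifs with h
    · cases s with
      | zero =>
        refine (hp ?_).elim
        have : i = k - 1 := by push_cast at h; omega
        rw [this]
      | succ s => rw [Function.iterate_succ_apply, d.map_one, iterate_zero_apply, mul_zero, smul_zero]
    · rw [iterate_zero_apply, mul_zero, smul_zero]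

/-! ### The projections -/

theorem coeff_negPart (X : PsiDO d) (k : ℤ) :
    (negPart X).coeff k = if k < 0 then X.coeff k else 0 := rfl

theorem coeff_nonnegPart (X : PsiDO d) (k : ℤ) :
    (nonnegPart X).coeff k = if 0 ≤ k then X.coeff k else 0 := rfl

theorem nonnegPart_add_negPart (X : PsiDO d) : nonnegPart X + negPart X = X := by
  ext k
  rw [coeff_add, coeff_negPart, coeff_nonnegPart]
  split_ifs <;> first | omega | simp

theorem nonnegPart_eq (X : PsiDO d) : nonnegPart X = X - negPart X :=
  eq_sub_of_add_eq (nonnegPart_add_negPart X)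

/-- `X ↦ X_{< 0}` as a linear map. -/
def negPartHom (d : Deriv K R₀) : PsiDO d →ₗ[K] PsiDO d where
  toFun := negPart
  map_add' X Y := by
    ext k
    simp only [coeff_add, coeff_negPart]
    split_ifs <;> simp
  map_smul' c X := by
    ext k
    simp only [coeff_smul, coeff_negPart, RingHom.id_apply]
    split_ifs <;> simp

theorem negPart_add (X Y : PsiDO d) : negPart (X + Y) = negPart X + negPart Y :=
  map_add (negPartHom d) X Y

theorem negPart_sub (X Y : PsiDO d) : negPart (X - Y) = negPart X - negPart Y :=
  map_sub (negPartHom d) X Y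

theorem negPart_neg (X : PsiDO d) : negPart (-X) = -negPart X := map_neg (negPartHom d) X

theorem ordLE_negPart (X : PsiDO d) : OrdLE (negPart X) (-1) := fun k hk => by
  rw [coeff_negPart, if_neg (by omega)]

theorem OrdLE.negPart {X : PsiDO d} {N : ℤ} (h : OrdLE X N) : OrdLE (negPart X) N := fun k hk => by
  rw [coeff_negPart, h k hk, ite_self]

theorem negPart_of_ordLE {X : PsiDO d} (h : OrdLE X (-1)) : negPart X = X := by
  ext k
  rw [coeff_negPart]
  split_ifs with hk
  · rfl
  · rw [h k (by omega)]

/-- `X` is a differential operator. -/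
def IsNonneg (X : PsiDO d) : Prop := ∀ k < 0, X.coeff k = 0

theorem isNonneg_nonnegPart (X : PsiDO d) : IsNonneg (nonnegPart X) := fun k hk => by
  rw [coeff_nonnegPart, if_neg (by omega)]

theorem isNonneg_const (a : R₀) : IsNonneg (const a : PsiDO d) := fun k hk => by
  rw [coeff_const, if_neg (by omega)]

/-- For `i ≥ 0` the binomial coefficient vanishes once `s > i`; for `s ≤ i` and `k < 0` the
coefficient of `Y` involved has negative index. -/
theorem IsNonneg.mul {X Y : PsiDO d} (hX : IsNonneg X) (hY : IsNonneg Y) : IsNonneg (X * Y) := by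
  intro k hk
  rw [coeff_mul, finsum_eq_zero_of_forall_eq_zero]
  rintro ⟨i, s⟩
  dsimp only
  rcases lt_or_ge i 0 with hi | hi
  · rw [hX i hi, zero_mul, smul_zero]
  · lift i to ℕ using hi
    rcases lt_or_ge i s with h | h
    · rw [Ring.choose_natCast, Nat.choose_eq_zero_of_lt h, Nat.cast_zero, zero_smul]
    · rw [hY _ (by omega), iterate_zero_apply, mul_zero, smul_zero]

theorem IsNonneg.negPart {X : PsiDO d} (hX : IsNonneg X) : negPart X = 0 := by
  ext k
  rw [coeff_negPart]
  split_ifs with hk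
  · exact hX k hk
  · rfl

theorem IsNonneg.nonnegPart {X : PsiDO d} (hX : IsNonneg X) : nonnegPart X = X := by
  rw [nonnegPart_eq, hX.negPart, sub_zero]

theorem IsNonneg.res {X : PsiDO d} (hX : IsNonneg X) : res X = 0 := hX (-1) (by omega)

theorem OrdLE.res {X : PsiDO d} {N : ℤ} (hX : OrdLE X N) (hN : N ≤ -2) : res X = 0 :=
  hX (-1) (by omega)

theorem OrdLE.nonnegPart_eq_const {X : PsiDO d} (hX : OrdLE X 0) :
    PsiDO.nonnegPart X = const (X.coeff 0) := by
  ext k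
  rw [coeff_nonnegPart, coeff_const]
  split_ifs with h1 h2 h2
  · rw [h2]
  · exact hX k (by omega)
  · omega
  · rfl

/-- `res` as a linear map. -/
def resHom (d : Deriv K R₀) : PsiDO d →ₗ[K] R₀ where
  toFun := res
  map_add' _ _ := rfl
  map_smul' _ _ := rfl

theorem res_add (X Y : PsiDO d) : res (X + Y) = res X + res Y := rfl

theorem res_sub (X Y : PsiDO d) : res (X - Y) = res X - res Y := rfl

theorem res_neg (X : PsiDO d) : res (-X) = -res X := rfl

theorem res_negPart (X : PsiDO d) : res (negPart X) = res X := rfl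

theorem res_const_mul (a : R₀) (X : PsiDO d) : res (const a * X) = a * res X :=
  coeff_const_mul a X (-1)

theorem const_mul_negPart (a : R₀) (X : PsiDO d) : negPart (const a * X) = const a * negPart X := by
  ext k
  simp only [coeff_negPart, coeff_const_mul, mul_ite, mul_zero]

theorem const_mul_nonnegPart (a : R₀) (X : PsiDO d) :
    nonnegPart (const a * X) = const a * nonnegPart X := by
  rw [nonnegPart_eq, nonnegPart_eq, const_mul_negPart, mul_sub]

/-- `const` as an additive map. -/
def constHom (d : Deriv K R₀) : R₀ →+ PsiDO d where
  toFun := const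
  map_zero' := by
    ext k
    rw [coeff_const, ite_self, coeff_zero]
  map_add' a b := by
    ext k
    simp only [coeff_const, coeff_add]
    split_ifs <;> simp

theorem const_neg (a : R₀) : (const (-a) : PsiDO d) = -const a := map_neg (constHom d) a

theorem ordLE_const (a : R₀) : OrdLE (const a : PsiDO d) 0 := ordLE_monomial a 0

/-! ### Derivations acting on the coefficients -/

theorem coeff_applyDeriv (δ : Deriv K R₀) (X : PsiDO d) (k : ℤ) :
    (applyDeriv δ X).coeff k = δ (X.coeff k) := rfl

/-- `applyDeriv δ` as a linear map. -/
def applyDerivHom (d δ : Deriv K R₀) : PsiDO d →ₗ[K] PsiDO d where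
  toFun := applyDeriv δ
  map_add' X Y := by
    ext k
    simp [coeff_applyDeriv]
  map_smul' c X := by
    ext k
    simp [coeff_applyDeriv]

theorem applyDeriv_neg (δ : Deriv K R₀) (X : PsiDO d) : applyDeriv δ (-X) = -applyDeriv δ X :=
  map_neg (applyDerivHom d δ) X

theorem applyDeriv_one (δ : Deriv K R₀) : applyDeriv δ (1 : PsiDO d) = 0 := by
  ext k
  rw [coeff_applyDeriv, coeff_one, apply_ite δ, δ.map_one, map_zero, ite_self, coeff_zero]

theorem applyDeriv_negPart (δ : Deriv K R₀) (X : PsiDO d) :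
    applyDeriv δ (negPart X) = negPart (applyDeriv δ X) := by
  ext k
  rw [coeff_applyDeriv, coeff_negPart, coeff_negPart, coeff_applyDeriv, apply_ite δ, map_zero]

theorem applyDeriv_nonnegPart (δ : Deriv K R₀) (X : PsiDO d) :
    applyDeriv δ (nonnegPart X) = nonnegPart (applyDeriv δ X) := by
  ext k
  rw [coeff_applyDeriv, coeff_nonnegPart, coeff_nonnegPart, coeff_applyDeriv, apply_ite δ, map_zero]

theorem res_applyDeriv (δ : Deriv K R₀) (X : PsiDO d) : res (applyDeriv δ X) = δ (res X) := rfl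

theorem OrdLE.applyDeriv (δ : Deriv K R₀) {X : PsiDO d} {N : ℤ} (hX : OrdLE X N) :
    OrdLE (applyDeriv δ X) N := fun k hk => by
  rw [coeff_applyDeriv, hX k hk, map_zero]

theorem iterate_comm {δ : Deriv K R₀} (h : ∀ a, δ (d a) = d (δ a)) (s : ℕ) (a : R₀) :
    δ (d^[s] a) = d^[s] (δ a) := by
  induction s generalizing a with
  | zero => rfl
  | succ s ih => rw [Function.iterate_succ_apply, Function.iterate_succ_apply, ih, h]

theorem applyDeriv_mul {δ : Deriv K R₀} (h : ∀ a, δ (d a) = d (δ a)) (X Y : PsiDO d) :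
    applyDeriv δ (X * Y) = applyDeriv δ X * Y + X * applyDeriv δ Y := by
  ext k
  obtain ⟨M, hM⟩ := exists_ordLE X
  obtain ⟨N, hN⟩ := exists_ordLE Y
  obtain ⟨S, hS⟩ := exists_box M N k
  rw [coeff_applyDeriv, coeff_add, coeff_mul_eq_sum hM hN hS,
    coeff_mul_eq_sum (hM.applyDeriv δ) hN hS, coeff_mul_eq_sum hM (hN.applyDeriv δ) hS,
    ← Finset.sum_add_distrib, map_sum]
  refine Finset.sum_congr rfl fun p _ => ?_
  rw [map_zsmul, δ.map_mul, iterate_comm h, smul_add, coeff_applyDeriv, coeff_applyDeriv]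

theorem applyDeriv_self (X : PsiDO d) :
    applyDeriv d X = partialOp d * X - X * partialOp d := by
  ext k
  rw [coeff_applyDeriv, coeff_sub, coeff_partialOp_mul, coeff_mul_partialOp]
  abel

/-! ### Inverses -/

theorem exists_inverse_one_sub {E : PsiDO d} (hE : OrdLE E (-1)) :
    ∃ G : PsiDO d, OrdLE G 0 ∧ (1 - E) * G = 1 ∧ G * (1 - E) = 1 := by
  have hEn : ∀ n : ℕ, OrdLE (E ^ n) (-n) := fun n => by simpa using hE.pow n
  -- This is the geometric series: `E ^ j` has order at most `-j`, so only `j ≤ -k` matters for the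
  -- coefficient of `∂ᵏ`.
  let G : PsiDO d := ⟨fun k => (∑ j ∈ Finset.range ((-k).toNat + 1), E ^ j).coeff k, 0,
    fun k hk => by
      beta_reduce
      rw [coeff_sum]
      exact Finset.sum_eq_zero fun j _ => hEn j k (by omega)⟩
  have hG : ∀ n : ℕ, OrdLE (G - ∑ j ∈ Finset.range n, E ^ j) (-n) := by
    intro n k hk
    rw [coeff_sub, sub_eq_zero]
    show (∑ j ∈ Finset.range ((-k).toNat + 1), E ^ j).coeff k = _
    rcases le_or_gt k 0 with hk0 | hk0
    · rw [coeff_sum, coeff_sum]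
      refine Finset.sum_subset (Finset.range_subset_range.2 (by omega)) fun j _ hj => ?_
      rw [Finset.mem_range] at hj
      exact hEn j k (by omega)
    · rw [coeff_sum, coeff_sum, Finset.sum_eq_zero, Finset.sum_eq_zero]
      · intro j _
        exact hEn j k (by omega)
      · intro j _
        exact hEn j k (by omega)
  have h1E : OrdLE (1 - E) 0 := (ordLE_monomial 1 0 : OrdLE 1 0).sub (hE.mono (by omega))
  refine ⟨G, by simpa using hG 0, ?_, ?_⟩
  · refine eq_of_forall_ordLE_sub fun n => ?_
    have h : (1 - E) * G - 1 = (1 - E) * (G - ∑ j ∈ Finset.range n, E ^ j) - E ^ n := by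
      rw [mul_sub, mul_neg_geom_sum]
      abel
    rw [h]
    exact ((h1E.mul (hG n)).mono (by omega)).sub (hEn n)
  · refine eq_of_forall_ordLE_sub fun n => ?_
    have h : G * (1 - E) - 1 = (G - ∑ j ∈ Finset.range n, E ^ j) * (1 - E) - E ^ n := by
      rw [sub_mul, geom_sum_mul_neg]
      abel
    rw [h]
    exact (((hG n).mul h1E).mono (by omega)).sub (hEn n)

theorem partialOp_mul_partialInv : partialOp d * monomial d 1 (-1) = 1 := by
  simpa using partialOp_mul_monomial (d := d) 1 (-1) |>.trans (by
    rw [d.map_one]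
    ext k
    simp [coeff_monomial, coeff_one])

/-- The product `∂⁻¹ X` is `1 - E` with `E` of negative order, so its geometric-series inverse `G`
yields the inverse `G ∂⁻¹` of `X`. -/
theorem exists_inverse {X : PsiDO d} (hX : OrdLE X 1) (h1 : X.coeff 1 = 1) :
    ∃ Y, OrdLE Y (-1) ∧ IsInverse X Y := by
  have hD : OrdLE (monomial d 1 (-1)) (-1) := ordLE_monomial 1 (-1)
  have hE : OrdLE (1 - monomial d 1 (-1) * X) (-1) := by
    intro k hk
    rw [coeff_sub, sub_eq_zero]
    rcases eq_or_ne k 0 with rfl | hk0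
    · have := coeff_mul_top hD hX
      rw [h1] at this
      simpa [coeff_one, coeff_monomial] using this.symm
    · rw [coeff_one, if_neg hk0]
      exact ((hD.mul hX) k (by omega)).symm
  obtain ⟨G, hG0, hG, hG'⟩ := exists_inverse_one_sub hE
  rw [sub_sub_cancel] at hG hG'
  refine ⟨G * monomial d 1 (-1), hG0.mul hD, ?_, ?_⟩
  · calc X * (G * monomial d 1 (-1))
        = partialOp d * monomial d 1 (-1) * X * (G * monomial d 1 (-1)) := by
          rw [partialOp_mul_partialInv, one_mul]
      _ = partialOp d * (monomial d 1 (-1) * X * G) * monomial d 1 (-1) := by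
          simp only [mul_assoc]
      _ = 1 := by rw [hG, mul_one, partialOp_mul_partialInv]
  · rw [mul_assoc, hG']

theorem isInverse_inverse {X Y : PsiDO d} (h : IsInverse X Y) : IsInverse X (inverse X) := by
  have hX : ∃ Y, IsInverse X Y := ⟨Y, h⟩
  rw [inverse, dif_pos hX]
  exact hX.choose_spec

theorem inverse_eq {X Y : PsiDO d} (h : IsInverse X Y) : inverse X = Y :=
  left_inv_eq_right_inv (isInverse_inverse h).2 h.1

/-! ### Formal sums -/

theorem hasFormalSum_of_remainder {f : ℕ → PsiDO d} {X : PsiDO d}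
    (h : ∀ n, OrdLE (X - ∑ m ∈ Finset.Icc 1 n, f m) (-n)) : HasFormalSum f X := fun k =>
  ⟨(-k).toNat + 1, fun n hn => (sub_eq_zero.1 (h n k (by omega))).symm⟩

theorem coeff_eq_of_hasFormalSum {f : ℕ → PsiDO d} {X : PsiDO d} (h : HasFormalSum f X)
    (hf : ∀ n, OrdLE (f n) (-n)) (n : ℕ) :
    X.coeff (-n) = ∑ m ∈ Finset.Icc 1 n, (f m).coeff (-n) := by
  obtain ⟨N₀, hN₀⟩ := h (-n)
  rw [← hN₀ (max N₀ n) (le_max_left _ _), coeff_sum]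
  refine (Finset.sum_subset (Finset.Icc_subset_Icc_right (le_max_right _ _)) fun m hm hm' => ?_).symm
  rw [Finset.mem_Icc] at hm hm'
  exact hf m _ (by omega)

/-- The system is triangular: the coefficient of `∂⁻ⁿ` sees only the terms up to the `n`-th, and it
determines the parameter of that last term. -/
theorem eq_of_hasFormalSum (f : ℕ → R₀ → PsiDO d) (hf : ∀ n a, OrdLE (f n a) (-n))
    (hinj : ∀ n a b, (f n a).coeff (-n) = (f n b).coeff (-n) → a = b) {s t : ℕ → R₀} {X : PsiDO d}
    (hs : HasFormalSum (fun n => f n (s n)) X) (ht : HasFormalSum (fun n => f n (t n)) X) :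
    ∀ n ≥ 1, s n = t n := by
  intro n
  induction n using Nat.strong_induction_on with
  | _ n ih =>
    intro hn
    obtain ⟨k, rfl⟩ : ∃ k, n = k + 1 := ⟨n - 1, by omega⟩
    have h := (coeff_eq_of_hasFormalSum hs (fun n => hf n _) (k + 1)).symm.trans
      (coeff_eq_of_hasFormalSum ht (fun n => hf n _) (k + 1))
    rw [Finset.sum_Icc_succ_top (by omega), Finset.sum_Icc_succ_top (by omega)] at h
    have hsum : ∑ m ∈ Finset.Icc 1 k, (f m (s m)).coeff (-(k + 1 : ℕ)) =
        ∑ m ∈ Finset.Icc 1 k, (f m (t m)).coeff (-(k + 1 : ℕ)) :=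
      Finset.sum_congr rfl fun m hm => by
        rw [Finset.mem_Icc] at hm
        rw [ih m (by omega) hm.1]
    rw [hsum] at h
    exact hinj _ _ _ (add_left_cancel h)

theorem hasFormalSum_congr {f g : ℕ → PsiDO d} {X : PsiDO d} (h : ∀ n ≥ 1, f n = g n)
    (hf : HasFormalSum f X) : HasFormalSum g X := fun k => by
  obtain ⟨N₀, hN₀⟩ := hf k
  refine ⟨N₀, fun N hN => ?_⟩
  rw [← hN₀ N hN]
  exact congrArg (fun Y => coeff Y k)
    (Finset.sum_congr rfl fun n hn => (h n (Finset.mem_Icc.1 hn).1).symm)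

end PsiDO

open PsiDO

/-! ### The Lax operator -/

variable (d : Deriv K R₀) (u : ℕ → R₀)

theorem coeff_Lax (k : ℤ) : (Lax d u).coeff k =
    if k = 1 then 1 else if k < 0 then u ((-k).toNat + 1) else 0 := rfl

theorem ordLE_Lax : OrdLE (Lax d u) 1 := fun k hk => by
  rw [coeff_Lax, if_neg (by omega), if_neg (by omega)]

theorem coeff_Lax_one : (Lax d u).coeff 1 = 1 := by rw [coeff_Lax, if_pos rfl]

theorem nonnegPart_Lax : nonnegPart (Lax d u) = partialOp d := by
  ext k
  rw [coeff_nonnegPart, coeff_Lax, partialOp, coeff_monomial]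
  split_ifs <;> first | rfl | omega

theorem isInverse_Lax : IsInverse (Lax d u) (inverse (Lax d u)) :=
  let ⟨_, _, h⟩ := exists_inverse (ordLE_Lax d u) (coeff_Lax_one d u)
  isInverse_inverse h

theorem ordLE_inverse_Lax : OrdLE (inverse (Lax d u)) (-1) := by
  obtain ⟨Y, hY, h⟩ := exists_inverse (ordLE_Lax d u) (coeff_Lax_one d u)
  rwa [inverse_eq h]

theorem coeff_inverse_Lax : (inverse (Lax d u)).coeff (-1) = 1 := by
  have h := coeff_mul_top (ordLE_Lax d u) (ordLE_inverse_Lax d u)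
  rw [(isInverse_Lax d u).1, coeff_Lax_one, one_mul] at h
  exact h.symm

theorem ordLE_inverse_Lax_pow (n : ℕ) : OrdLE (inverse (Lax d u) ^ n) (-n) := by
  simpa using (ordLE_inverse_Lax d u).pow n

theorem coeff_inverse_Lax_pow (n : ℕ) : (inverse (Lax d u) ^ n).coeff (-n) = 1 := by
  induction n with
  | zero => rfl
  | succ n ih =>
    have h := coeff_mul_top (ordLE_inverse_Lax_pow d u n) (ordLE_inverse_Lax d u)
    rw [ih, coeff_inverse_Lax, ← pow_succ, one_mul] at h
    rw [← h]
    push_cast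
    ring_nf

theorem isSigma_unique {m : ℕ} {s t : ℕ → R₀} (hs : IsSigma d u m s) (ht : IsSigma d u m t) :
    ∀ n ≥ 1, s n = t n := by
  refine eq_of_hasFormalSum (fun n a => -(const a * pow (inverse (Lax d u)) n)) (fun n a => ?_)
    (fun n a b h => ?_) hs ht
  · rw [pow_eq]
    exact (((ordLE_const a).mul (ordLE_inverse_Lax_pow d u n)).mono (by omega)).neg
  · simpa only [pow_eq, coeff_neg, coeff_const_mul, coeff_inverse_Lax_pow, mul_one, neg_inj] using h

theorem isEta_unique {m : ℕ} {s t : ℕ → R₀} (hs : IsEta d u m s) (ht : IsEta d u m t) :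
    ∀ n ≥ 1, s n = t n := by
  refine eq_of_hasFormalSum (fun n a => pow (inverse (Lax d u)) n * const a) (fun n a => ?_)
    (fun n a b h => ?_) hs ht
  · rw [pow_eq]
    exact ((ordLE_inverse_Lax_pow d u n).mul (ordLE_const a)).mono (by omega)
  · have key : ∀ a : R₀, (inverse (Lax d u) ^ n * const a).coeff (-n) = a := fun a => by
      have h := coeff_mul_top (ordLE_inverse_Lax_pow d u n) (ordLE_const (d := d) a)
      rw [add_zero] at h
      rw [h, coeff_inverse_Lax_pow, one_mul, coeff_const, if_pos rfl]
    simpa only [pow_eq, key] using h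

theorem IsSigma.congr {m : ℕ} {s t : ℕ → R₀} (hs : IsSigma d u m s) (h : ∀ n ≥ 1, t n = s n) :
    IsSigma d u m t :=
  hasFormalSum_congr (fun n hn => by rw [h n hn]) hs

theorem IsEta.congr {m : ℕ} {s t : ℕ → R₀} (hs : IsEta d u m s) (h : ∀ n ≥ 1, t n = s n) :
    IsEta d u m t :=
  hasFormalSum_congr (fun n hn => by rw [h n hn]) hs

/-- If `X` has negative order, then `X = ∑ aₙ L⁻ⁿ` where `aₙ` are the residues of the successive
remainders `X ↦ (X L)_{< 0}`. -/
theorem hasFormalSum_right {X : PsiDO d} (hX : OrdLE X (-1)) :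
    HasFormalSum (fun n => const (res ((fun Y => negPart (Y * Lax d u))^[n - 1] X)) *
      inverse (Lax d u) ^ n) X := by
  set f : PsiDO d → PsiDO d := fun Y => negPart (Y * Lax d u) with hf
  have hneg : ∀ n, OrdLE (f^[n] X) (-1) := by
    intro n
    cases n with
    | zero => exact hX
    | succ n =>
      rw [Function.iterate_succ_apply']
      exact ordLE_negPart _
  have hrem : ∀ n, X - ∑ m ∈ Finset.Icc 1 n, const (res (f^[m - 1] X)) * inverse (Lax d u) ^ m =
      f^[n] X * inverse (Lax d u) ^ n := by
    intro n
    induction n with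
    | zero => simp
    | succ n ih =>
      rw [Finset.sum_Icc_succ_top (by omega), ← sub_sub, ih, add_tsub_cancel_right,
        Function.iterate_succ_apply', hf, pow_succ' _ n, ← mul_assoc, ← mul_assoc, ← sub_mul]
      beta_reduce
      rw [← hf]
      -- The product `f^[n] X * L` has order at most zero. Its constant part is the residue of
      -- `f^[n] X`, since `L` has leading coefficient 1, and its negative part is the next
      -- remainder.
      have h0 := (hneg n).mul (ordLE_Lax d u)
      have h1 := nonnegPart_add_negPart (f^[n] X * Lax d u)
      rw [OrdLE.nonnegPart_eq_const h0] at h1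
      have h2 := coeff_mul_top (hneg n) (ordLE_Lax d u)
      rw [coeff_Lax_one, mul_one] at h2
      have h3 : f^[n] X = f^[n] X * Lax d u * inverse (Lax d u) := by
        rw [mul_assoc, (isInverse_Lax d u).1, mul_one]
      have h4 : res (f^[n] X) = (f^[n] X * Lax d u).coeff 0 := h2.symm
      rw [h4]
      conv_lhs => enter [1, 1]; rw [h3]
      rw [← sub_mul, ← eq_sub_of_add_eq' h1]
  refine hasFormalSum_of_remainder fun n => ?_
  rw [hrem]
  exact ((hneg n).mul (ordLE_inverse_Lax_pow d u n)).mono (by omega)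

/-- If `X` has negative order, then `X = ∑ L⁻ⁿ aₙ` where `aₙ` are the residues of the successive
remainders `X ↦ (L X)_{< 0}`. -/
theorem hasFormalSum_left {X : PsiDO d} (hX : OrdLE X (-1)) :
    HasFormalSum (fun n => inverse (Lax d u) ^ n *
      const (res ((fun Y => negPart (Lax d u * Y))^[n - 1] X))) X := by
  set f : PsiDO d → PsiDO d := fun Y => negPart (Lax d u * Y) with hf
  have hneg : ∀ n, OrdLE (f^[n] X) (-1) := by
    intro n
    cases n with
    | zero => exact hX
    | succ n =>
      rw [Function.iterate_succ_apply']
      exact ordLE_negPart _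
  have hrem : ∀ n, X - ∑ m ∈ Finset.Icc 1 n, inverse (Lax d u) ^ m * const (res (f^[m - 1] X)) =
      inverse (Lax d u) ^ n * f^[n] X := by
    intro n
    induction n with
    | zero => simp
    | succ n ih =>
      rw [Finset.sum_Icc_succ_top (by omega), ← sub_sub, ih, add_tsub_cancel_right,
        Function.iterate_succ_apply', hf, pow_succ _ n, mul_assoc, mul_assoc, ← mul_sub]
      beta_reduce
      rw [← hf]
      have h0 := (ordLE_Lax d u).mul (hneg n)
      have h1 := nonnegPart_add_negPart (Lax d u * f^[n] X)
      rw [OrdLE.nonnegPart_eq_const h0] at h1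
      have h2 := coeff_mul_top (ordLE_Lax d u) (hneg n)
      rw [coeff_Lax_one, one_mul] at h2
      have h3 : f^[n] X = inverse (Lax d u) * (Lax d u * f^[n] X) := by
        rw [← mul_assoc, (isInverse_Lax d u).2, one_mul]
      have h4 : res (f^[n] X) = (Lax d u * f^[n] X).coeff 0 := h2.symm
      rw [h4]
      conv_lhs => enter [2, 1]; rw [h3]
      rw [← mul_sub, ← eq_sub_of_add_eq' h1]
  refine hasFormalSum_of_remainder fun n => ?_
  rw [hrem]
  exact ((ordLE_inverse_Lax_pow d u n).mul (hneg n)).mono (by omega)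

end

section

variable {K : Type u} {R₀ : Type v} [Field K] [Ring R₀] [Algebra K R₀]

/-! ### Bilinear products on `A(P)` -/

namespace AP

/-- The bilinear product on `A(P)` with prescribed values on pairs of words. -/
def bilin (f : Word → Word → AP K) : AP K →ₗ[K] AP K →ₗ[K] AP K :=
  Finsupp.linearCombination K fun v => Finsupp.linearCombination K (f v)

theorem bilin_apply (f : Word → Word → AP K) (α β : AP K) :
    bilin f α β = α.sum fun v x => β.sum fun w y => (x * y) • f v w := by
  simp only [bilin, Finsupp.linearCombination_apply, Finsupp.sum, LinearMap.sum_apply,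
    LinearMap.smul_apply, Finset.smul_sum, smul_smul]

theorem bilin_single (f : Word → Word → AP K) (v w : Word) (x y : K) :
    bilin f (Finsupp.single v x) (Finsupp.single w y) = (x * y) • f v w := by
  simp [bilin, smul_smul]

/-- The product of `A(P)` given by a product symbol. -/
def op (s : Sep) : AP K →ₗ[K] AP K →ₗ[K] AP K :=
  bilin fun v w => Finsupp.single (v ++ s :: w) 1

theorem op_single (s : Sep) (v w : Word) (x y : K) :
    op s (Finsupp.single v x) (Finsupp.single w y) = Finsupp.single (v ++ s :: w) (x * y) := by
  simp [op, bilin_single]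

theorem prec_eq (α β : AP K) : prec α β = op Sep.prec α β := by
  simp [prec, op, bilin_apply]

theorem succ_eq (α β : AP K) : succ α β = op Sep.succ α β := by
  simp [succ, op, bilin_apply]

theorem circ_eq (α β : AP K) : circ α β = bilin circWord α β := (bilin_apply _ _ _).symm

/-- Linear maps on `A(P)` agree if they agree on words. -/
theorem hom_ext {M : Type*} [AddCommMonoid M] [Module K M] {f g : AP K →ₗ[K] M}
    (h : ∀ w, f (Finsupp.single w 1) = g (Finsupp.single w 1)) (α : AP K) : f α = g α :=
  DFunLike.congr_fun (Finsupp.lhom_ext' fun w => LinearMap.ext_ring (h w)) α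

/-- The products `≺` and `≻` are associative and mutually associative. -/
theorem op_assoc (s t : Sep) (α β γ : AP K) :
    op t (op s α β) γ = op s α (op t β γ) := by
  induction α using Finsupp.induction_linear with
  | zero => simp
  | add α α' h h' => simp only [map_add, LinearMap.add_apply, h, h']
  | single v x =>
    induction β using Finsupp.induction_linear with
    | zero => simp
    | add β β' h h' => simp only [map_add, LinearMap.add_apply, h, h']
    | single w y =>
      induction γ using Finsupp.induction_linear with
      | zero => simp
      | add γ γ' h h' => simp only [map_add, h, h']
      | single z c => simp only [op_single, List.append_assoc, List.cons_append, mul_assoc]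

theorem prec_assoc (α β γ : AP K) : prec (prec α β) γ = prec α (prec β γ) := by
  simp only [prec_eq, op_assoc]

theorem succ_assoc (α β γ : AP K) : succ (succ α β) γ = succ α (succ β γ) := by
  simp only [succ_eq, op_assoc]

theorem succ_prec (α β γ : AP K) : succ (prec α β) γ = prec α (succ β γ) := by
  simp only [prec_eq, succ_eq, op_assoc]

theorem prec_succ (α β γ : AP K) : prec (succ α β) γ = succ α (prec β γ) := by
  simp only [prec_eq, succ_eq, op_assoc]

theorem prec_sub_right (α β γ : AP K) : prec α (β - γ) = prec α β - prec α γ := by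
  simp only [prec_eq, map_sub]

theorem succ_sub_right (α β γ : AP K) : succ α (β - γ) = succ α β - succ α γ := by
  simp only [succ_eq, map_sub]

theorem prec_sub_left (α β γ : AP K) : prec (α - β) γ = prec α γ - prec β γ := by
  simp only [prec_eq, map_sub, LinearMap.sub_apply]

theorem succ_sub_left (α β γ : AP K) : succ (α - β) γ = succ α γ - succ β γ := by
  simp only [succ_eq, map_sub, LinearMap.sub_apply]

theorem prec_smul_left (c : K) (α β : AP K) : prec (c • α) β = c • prec α β := by
  simp only [prec_eq, map_smul, LinearMap.smul_apply]

theorem prec_neg_left (α β : AP K) : prec (-α) β = -prec α β := by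
  simp only [prec_eq, map_neg, LinearMap.neg_apply]

theorem bullet_assoc (α β γ : AP K) : bullet (bullet α β) γ = bullet α (bullet β γ) := by
  simp only [bullet, succ_sub_right, succ_sub_left, prec_sub_left, prec_sub_right, prec_assoc,
    succ_assoc, succ_prec, prec_succ]
  abel

theorem prec_bullet (α β γ : AP K) : bullet (prec α β) γ = prec α (bullet β γ) := by
  simp only [bullet, prec_sub_right, prec_assoc, succ_prec]

theorem succ_bullet (α β γ : AP K) : bullet (succ α β) γ = succ α (bullet β γ) := by
  simp only [bullet, succ_sub_right, succ_assoc, prec_succ]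

theorem opPow_one (f : AP K → AP K → AP K) (α : AP K) : opPow f α 1 = α := rfl

theorem opPow_succ (f : AP K → AP K → AP K) (α : AP K) {n : ℕ} (hn : 1 ≤ n) :
    opPow f α (n + 1) = f (opPow f α n) α := by
  cases n with
  | zero => omega
  | succ n => rfl

theorem opPow_succ' {f : AP K → AP K → AP K} (hf : ∀ α β γ, f (f α β) γ = f α (f β γ)) (α : AP K)
    {n : ℕ} (hn : 1 ≤ n) : opPow f α (n + 1) = f α (opPow f α n) := by
  induction n, hn using Nat.le_induction with
  | base => rfl
  | succ n hn ih => rw [opPow_succ f α (by omega), ih, hf, ← opPow_succ f α hn, ih]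

theorem Pn_one : (Pn 1 : AP K) = P := rfl

theorem Pn_succ {n : ℕ} (hn : 1 ≤ n) : (Pn (n + 1) : AP K) = bullet (Pn n) P :=
  opPow_succ _ _ hn

theorem Pn_succ' {n : ℕ} (hn : 1 ≤ n) : (Pn (n + 1) : AP K) = bullet P (Pn n) :=
  opPow_succ' bullet_assoc _ hn

theorem C_one (m : ℕ) : (C m 1 : AP K) = -Pn m := if_pos rfl

/-- In this recursive form the sign cancels the one in the rule for `≺`: `ℓ` of the next element is
`ℓ(C)_{<0} L`, one step of the division on the right. -/
theorem C_succ (m : ℕ) {n : ℕ} (hn : 1 ≤ n) : (C m (n + 1) : AP K) = -prec (C m n) P := by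
  rw [C, if_neg (by omega), add_tsub_cancel_right]
  rcases eq_or_ne n 1 with rfl | h
  · rw [C_one, prec_neg_left, opPow_one]
    simp
  · obtain ⟨k, rfl⟩ : ∃ k, n = k + 1 := ⟨n - 1, by omega⟩
    rw [C, if_neg h, add_tsub_cancel_right, prec_smul_left, prec_assoc,
      opPow_succ _ _ (by omega), pow_succ]
    simp

theorem H_one (m : ℕ) : (H m 1 : AP K) = Pn m := if_pos rfl

theorem H_succ (m : ℕ) {n : ℕ} (hn : 1 ≤ n) : (H m (n + 1) : AP K) = succ P (H m n) := by
  rw [H, if_neg (by omega), add_tsub_cancel_right]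
  rcases eq_or_ne n 1 with rfl | h
  · rw [H_one, opPow_one]
  · obtain ⟨k, rfl⟩ : ∃ k, n = k + 1 := ⟨n - 1, by omega⟩
    rw [H, if_neg h, add_tsub_cancel_right, ← succ_assoc, opPow_succ' succ_assoc _ (by omega)]

end AP

open AP PsiDO

/-! ### The map `ℓ` with an arbitrary initial operator -/

variable (d : Deriv K R₀) (u : ℕ → R₀)

/-- One step of `ℓ` as a linear map. -/
def ellStepHom (s : Sep) : PsiDO d →ₗ[K] PsiDO d :=
  match s with
  | Sep.prec => (LinearMap.mulRight K (Lax d u)).comp (-negPartHom d)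
  | Sep.succ => (LinearMap.mulRight K (Lax d u)).comp (LinearMap.id - negPartHom d)

theorem ellStepHom_apply (s : Sep) (X : PsiDO d) : ellStepHom d u s X = ellStep d u X s := by
  cases s with
  | prec => rfl
  | succ =>
    show (X - negPart X) * Lax d u = nonnegPart X * Lax d u
    rw [nonnegPart_eq]

/-- The linear map on `A(P)` which obeys the recursion of `ℓ`, but has the value `X` at `P`. -/
def ellFrom (X : PsiDO d) : AP K →ₗ[K] PsiDO d :=
  Finsupp.linearCombination K fun w : Word => w.foldl (ellStep d u) X

theorem ell_eq : (ell d u : AP K →ₗ[K] PsiDO d) = ellFrom d u (Lax d u) := rfl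

theorem ellFrom_single (X : PsiDO d) (w : Word) (x : K) :
    ellFrom d u X (Finsupp.single w x) = x • w.foldl (ellStep d u) X := by
  simp [ellFrom]

theorem ellFrom_P (X : PsiDO d) : ellFrom d u X (P : AP K) = X := by
  simp [P, ellFrom_single]

/-- `foldl` of the steps of `ℓ` along a word as a linear map. -/
def foldHom (w : Word) : PsiDO d →ₗ[K] PsiDO d :=
  w.foldl (fun f s => (ellStepHom d u s).comp f) LinearMap.id

theorem foldHom_apply (w : Word) (X : PsiDO d) :
    foldHom d u w X = w.foldl (ellStep d u) X := by
  induction w using List.reverseRecOn with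
  | nil => rfl
  | append_singleton w s ih =>
    rw [foldHom, List.foldl_append, List.foldl_append, ← ih, ← foldHom]
    simp [ellStepHom_apply]

/-- `ellFrom` as a linear map in the initial operator. -/
def ellFromHom (α : AP K) : PsiDO d →ₗ[K] PsiDO d :=
  Finsupp.linearCombination K (foldHom d u) α

theorem ellFromHom_apply (α : AP K) (X : PsiDO d) : ellFromHom d u α X = ellFrom d u X α := by
  simp [ellFromHom, ellFrom, Finsupp.linearCombination_apply, Finsupp.sum, foldHom_apply]

theorem ellFrom_zero (α : AP K) : ellFrom d u 0 α = 0 := by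
  simp only [← ellFromHom_apply, map_zero]

/-- Concatenating words composes the folds, so the first factor enters only through the operator
from which the second one starts. -/
theorem ellFrom_op (s : Sep) (X : PsiDO d) (α β : AP K) :
    ellFrom d u X (op s α β) = ellFrom d u (ellStep d u (ellFrom d u X α) s) β := by
  induction α using Finsupp.induction_linear with
  | zero => simp [← ellStepHom_apply, ellFrom_zero]
  | add α α' h h' =>
    simp only [map_add, LinearMap.add_apply, h, h', ← ellStepHom_apply, ← ellFromHom_apply]
  | single v x =>
    induction β using Finsupp.induction_linear with
    | zero => simp
    | add β β' h h' => simp only [map_add, h, h']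
    | single w y =>
      rw [op_single, ellFrom_single, ellFrom_single, ellFrom_single, ← ellStepHom_apply, map_smul,
        ← foldHom_apply d u w, map_smul, foldHom_apply, ellStepHom_apply, List.foldl_append,
        List.foldl_cons, smul_smul, mul_comm]

theorem ellFrom_prec (X : PsiDO d) (α β : AP K) :
    ellFrom d u X (prec α β) = ellFrom d u (-negPart (ellFrom d u X α) * Lax d u) β := by
  rw [prec_eq, ellFrom_op]
  rfl

theorem ellFrom_succ (X : PsiDO d) (α β : AP K) :
    ellFrom d u X (succ α β) = ellFrom d u (nonnegPart (ellFrom d u X α) * Lax d u) β := by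
  rw [succ_eq, ellFrom_op]
  rfl

theorem ellFrom_bullet_P (X : PsiDO d) (α : AP K) :
    ellFrom d u X (bullet α P) = ellFrom d u X α * Lax d u := by
  rw [bullet, map_sub, ellFrom_prec, ellFrom_succ, ellFrom_P, ellFrom_P, ← sub_mul, sub_neg_eq_add,
    nonnegPart_add_negPart]

theorem ellFrom_Pn (X : PsiDO d) (n : ℕ) :
    ellFrom d u X (Pn (n + 1) : AP K) = X * Lax d u ^ n := by
  induction n with
  | zero => rw [zero_add, Pn_one, ellFrom_P, pow_zero, mul_one]
  | succ n ih => rw [Pn_succ (by omega), ellFrom_bullet_P, ih, pow_succ, mul_assoc]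

theorem ellFrom_mul_Lax_Pn (X : PsiDO d) {n : ℕ} (hn : 1 ≤ n) :
    ellFrom d u (X * Lax d u) (Pn n : AP K) = X * Lax d u ^ n := by
  obtain ⟨k, rfl⟩ : ∃ k, n = k + 1 := ⟨n - 1, by omega⟩
  rw [ellFrom_Pn, mul_assoc, pow_succ']

theorem ell_Pn {n : ℕ} (hn : 1 ≤ n) : ell d u (Pn n : AP K) = Lax d u ^ n := by
  have := ellFrom_mul_Lax_Pn (K := K) d u 1 hn
  rwa [one_mul, one_mul] at this

/-- Left multiplication by a coefficient commutes with both projections and with right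
multiplication by `L`. -/
theorem foldl_const_mul (a : R₀) (X : PsiDO d) (w : Word) :
    w.foldl (ellStep d u) (const a * X) = const a * w.foldl (ellStep d u) X := by
  induction w generalizing X with
  | nil => rfl
  | cons s w ih =>
    rw [List.foldl_cons, List.foldl_cons, ← ih]
    congr 1
    cases s
    · simp only [ellStep, const_mul_negPart, neg_mul, mul_neg, mul_assoc]
    · simp only [ellStep, const_mul_nonnegPart, mul_assoc]

theorem ellFrom_const_mul (a : R₀) (X : PsiDO d) (α : AP K) :
    ellFrom d u (const a * X) α = const a * ellFrom d u X α := by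
  refine hom_ext (f := ellFrom d u (const a * X))
    (g := (LinearMap.mulLeft K (const a)).comp (ellFrom d u X)) (fun w => ?_) α
  simp only [LinearMap.comp_apply, LinearMap.mulLeft_apply, ellFrom_single, one_smul,
    foldl_const_mul]

/-- After `α ≺ P` the operator has order at most zero, with constant coefficient `-Φ(α)`. The
following `≻` keeps just this coefficient, so the recursion along `β` restarts at `-Φ(α) L`. -/
theorem Phi_hcross (α β : AP K) : Phi d u (hcross α β) = Phi d u α * Phi d u β := by
  have h0 : OrdLE (-negPart (ell d u α) * Lax d u) 0 :=
    ((ordLE_negPart _).neg.mul (ordLE_Lax d u)).mono (by omega)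
  have h1 := coeff_mul_top (ordLE_negPart (ell d u α)).neg (ordLE_Lax d u)
  rw [coeff_Lax_one, mul_one] at h1
  rw [Phi, hcross, map_neg, ell_eq, ellFrom_succ, ellFrom_prec, ellFrom_P, ← ell_eq,
    OrdLE.nonnegPart_eq_const h0, ellFrom_const_mul, ← ell_eq, res_neg, res_const_mul]
  rw [show (0 : ℤ) = -1 + 1 from rfl, h1]
  simp [Phi, res, coeff_negPart]

/-! ### The elements `C` and `H` -/

theorem isSigma_Phi_C {m : ℕ} (hm : 1 ≤ m) :
    IsSigma d u m (fun n => Phi d u (C m n : AP K)) := by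
  set f : PsiDO d → PsiDO d := fun Y => negPart (Y * Lax d u) with hf
  -- The negative parts are, up to sign, the successive remainders of `hasFormalSum_right`.
  have key : ∀ n, negPart (ell d u (C m (n + 1) : AP K)) = -f^[n] (negPart (Lax d u ^ m)) := by
    intro n
    induction n with
    | zero => rw [zero_add, C_one, map_neg, ell_Pn d u hm, PsiDO.negPart_neg]; rfl
    | succ n ih =>
      rw [C_succ m (by omega), map_neg, ell_eq, ellFrom_prec, ellFrom_P, ← ell_eq, ih,
        Function.iterate_succ_apply', PsiDO.negPart_neg, neg_neg, hf]
  refine hasFormalSum_congr (fun n hn => ?_) (hasFormalSum_right d u (ordLE_negPart (pow (Lax d u) m)))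
  obtain ⟨k, rfl⟩ : ∃ k, n = k + 1 := ⟨n - 1, by omega⟩
  beta_reduce
  rw [pow_eq, pow_eq, Phi, ← res_negPart (ell d u _), key, res_neg, const_neg, neg_mul, neg_neg,
    add_tsub_cancel_right]

theorem isEta_Phi_H {m : ℕ} (hm : 1 ≤ m) :
    IsEta d u m (fun n => Phi d u (H m n : AP K)) := by
  set f : PsiDO d → PsiDO d := fun Y => negPart (Lax d u * Y) with hf
  -- In `H` the new factor `P ≻` stands on the left, where it changes the initial operator. The
  -- induction therefore needs a general start `A L` with `A` a differential operator; `A = 1` gives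
  -- `ℓ`.
  have hA : ∀ n (A : PsiDO d), IsNonneg A →
      res (ellFrom d u (A * Lax d u) (H m (n + 1) : AP K)) =
        res (A * f^[n] (negPart (Lax d u ^ m))) := by
    have hres : ∀ A X : PsiDO d, IsNonneg A → res (A * X) = res (A * negPart X) := by
      intro A X hA
      conv_lhs => rw [← nonnegPart_add_negPart X]
      rw [mul_add, res_add, (hA.mul (isNonneg_nonnegPart X)).res, zero_add]
    intro n
    induction n with
    | zero =>
      intro A hA
      rw [zero_add, H_one, ellFrom_mul_Lax_Pn d u A hm, hres A _ hA]
      rfl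
    | succ n ih =>
      intro A hA
      have hN : OrdLE (f^[n] (negPart (Lax d u ^ m))) (-1) := by
        cases n with
        | zero => exact ordLE_negPart _
        | succ n =>
          rw [Function.iterate_succ_apply']
          exact ordLE_negPart _
      have h2 : negPart (A * Lax d u) * f^[n] (negPart (Lax d u ^ m)) =
          A * Lax d u * f^[n] (negPart (Lax d u ^ m)) -
            nonnegPart (A * Lax d u) * f^[n] (negPart (Lax d u ^ m)) := by
        rw [nonnegPart_eq, sub_mul, sub_sub_cancel]
      -- A product of two operators of negative order has no residue, so `(A L)_{≥0}` may be
      -- replaced by `A L` under the residue.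
      have h3 := (ordLE_negPart (A * Lax d u)).mul hN |>.res (by omega)
      rw [h2, res_sub, sub_eq_zero] at h3
      rw [H_succ m (by omega), ellFrom_succ, ellFrom_P, ih _ (isNonneg_nonnegPart _),
        Function.iterate_succ_apply', hf]
      rw [← hf, ← h3, mul_assoc, hres A _ hA]
  refine hasFormalSum_congr (fun n hn => ?_) (hasFormalSum_left d u (ordLE_negPart (pow (Lax d u) m)))
  obtain ⟨k, rfl⟩ : ∃ k, n = k + 1 := ⟨n - 1, by omega⟩
  have h := hA k 1 (isNonneg_const 1)
  rw [one_mul, one_mul, ← ell_eq] at h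
  beta_reduce
  rw [pow_eq, pow_eq, Phi, h, add_tsub_cancel_right]

end

section

variable {K : Type u} [Field K]

namespace AP

/-! ### Shuffles, decomposed according to the last letter -/

section shuffles

variable {T : Type*} {M : Type*} [AddCommMonoid M]

/-- The sum of the values of `f` at the shuffles of two lists. -/
def shuffleSum (f : List T → M) (xs ys : List T) : M := ((shuffles xs ys).map f).sum

theorem shuffleSum_nil_left (f : List T → M) (ys : List T) : shuffleSum f [] ys = f ys := by
  simp [shuffleSum, shuffles]

theorem shuffleSum_nil_right (f : List T → M) (xs : List T) : shuffleSum f xs [] = f xs := by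
  cases xs <;> simp [shuffleSum, shuffles]

theorem shuffleSum_cons_cons (f : List T → M) (x y : T) (xs ys : List T) :
    shuffleSum f (x :: xs) (y :: ys) =
      shuffleSum (fun l => f (x :: l)) xs (y :: ys) +
        shuffleSum (fun l => f (y :: l)) (x :: xs) ys := by
  simp [shuffleSum, shuffles, Function.comp_def]

/-- Shuffles are defined by their first letter, whereas `ℓ` and the powers `P_n` grow at the right
end; hence this decomposition by the last letter. -/
theorem shuffleSum_concat_concat (f : List T → M) (x y : T) (xs ys : List T) :
    shuffleSum f (xs ++ [x]) (ys ++ [y]) =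
      shuffleSum (fun l => f (l ++ [x])) xs (ys ++ [y]) +
        shuffleSum (fun l => f (l ++ [y])) (xs ++ [x]) ys := by
  induction xs generalizing f ys with
  | nil =>
    induction ys generalizing f with
    | nil =>
      simp only [List.nil_append, shuffleSum_cons_cons, shuffleSum_nil_left, shuffleSum_nil_right,
        List.cons_append]
      rw [add_comm]
    | cons b ys ih =>
      simp only [List.nil_append, List.cons_append, shuffleSum_cons_cons, shuffleSum_nil_left] at ih ⊢
      rw [ih]
      abel
  | cons a xs ihx =>
    induction ys generalizing f with
    | nil =>
      have h := ihx (fun l => f (a :: l)) []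
      simp only [List.nil_append, List.cons_append, shuffleSum_cons_cons,
        shuffleSum_nil_right] at h ⊢
      rw [h]
      abel
    | cons b ys ih =>
      have h := ihx (fun l => f (a :: l)) (b :: ys)
      simp only [List.cons_append, shuffleSum_cons_cons] at h ih ⊢
      rw [h, ih]
      abel

theorem shuffleSum_congr {f g : List T → M} (h : ∀ l, f l = g l) (xs ys : List T) :
    shuffleSum f xs ys = shuffleSum g xs ys := by
  rw [funext h]

theorem map_shuffleSum {N : Type*} [AddCommMonoid N] (φ : M →+ N) (f : List T → M)
    (xs ys : List T) : φ (shuffleSum f xs ys) = shuffleSum (fun l => φ (f l)) xs ys := by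
  simp [shuffleSum, map_list_sum, Function.comp_def]

end shuffles

theorem toWord_concat_concat (l : List Letter) (a b : Letter) :
    toWord (l ++ [a] ++ [b]) = toWord (l ++ [a]) ++ [joint a b] := by
  induction l with
  | nil => rfl
  | cons c l ih =>
    cases l with
    | nil => rfl
    | cons c' l => simpa [toWord] using ih

theorem toWord_concat_sep (l : List Letter) (b : Bool) (s t : Sep) :
    toWord (l ++ [⟨b, s⟩]) = toWord (l ++ [⟨b, t⟩]) := by
  induction l with
  | nil => rfl
  | cons c l ih =>
    cases l with
    | nil => rfl
    | cons c' l => simpa [toWord] using ih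

theorem toWord_letters (b : Bool) (w : Word) (a : Letter) :
    toWord (letters b w ++ [a]) = w ++ [joint ⟨b, Sep.prec⟩ a] := by
  induction w with
  | nil => rfl
  | cons s w ih =>
    have h : toWord (letters b (s :: w) ++ [a]) = s :: toWord (letters b w ++ [a]) := by
      cases w <;> cases b <;> simp [letters, toWord, joint]
    rw [h, ih, List.cons_append]

/-- The product symbol following the last letter of the first word does not matter in a shuffle
that continues with a letter of the second word. -/
theorem shuffleSum_sep_left {M : Type*} [AddCommMonoid M] (f : Word → M) (xs : List Letter)
    (w : Word) (s t p : Sep) :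
    shuffleSum (fun l => f (toWord (l ++ [⟨false, p⟩]))) (xs ++ [⟨true, s⟩])
        (w.map fun q => ⟨false, q⟩) =
      shuffleSum (fun l => f (toWord (l ++ [⟨false, p⟩]))) (xs ++ [⟨true, t⟩])
        (w.map fun q => ⟨false, q⟩) := by
  induction w using List.reverseRecOn generalizing f p with
  | nil =>
    simp only [List.map_nil, shuffleSum_nil_right, toWord_concat_concat]
    rw [toWord_concat_sep xs true s t]
    rfl
  | append_singleton w q ih =>
    simp only [List.map_append, List.map_cons, List.map_nil, shuffleSum_concat_concat,
      toWord_concat_concat]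
    congr 1
    · refine shuffleSum_congr (fun l => ?_) _ _
      rw [toWord_concat_sep l true s t]
      rfl
    · exact ih (fun z => f (z ++ [joint ⟨false, q⟩ ⟨false, p⟩])) q

/-- The product symbol following the last letter of the second word does not matter in a shuffle
that continues with a letter of the first word. -/
theorem shuffleSum_sep_right {M : Type*} [AddCommMonoid M] (f : Word → M) (ys : List Letter)
    (v : Word) (s t p : Sep) :
    shuffleSum (fun l => f (toWord (l ++ [⟨true, p⟩]))) (v.map fun q => ⟨true, q⟩)
        (ys ++ [⟨false, s⟩]) =
      shuffleSum (fun l => f (toWord (l ++ [⟨true, p⟩]))) (v.map fun q => ⟨true, q⟩)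
        (ys ++ [⟨false, t⟩]) := by
  induction v using List.reverseRecOn generalizing f p with
  | nil =>
    simp only [List.map_nil, shuffleSum_nil_left, toWord_concat_concat]
    rw [toWord_concat_sep ys false s t]
    rfl
  | append_singleton v q ih =>
    simp only [List.map_append, List.map_cons, List.map_nil, shuffleSum_concat_concat,
      toWord_concat_concat]
    congr 1
    · exact ih (fun z => f (z ++ [joint ⟨true, q⟩ ⟨true, p⟩])) q
    · refine shuffleSum_congr (fun l => ?_) _ _
      rw [toWord_concat_sep l false s t]
      rfl

theorem letters_eq (b : Bool) (w : Word) :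
    letters b w = (w.map fun s => ⟨b, s⟩) ++ [⟨b, Sep.prec⟩] := by
  simp [letters]

/-- The part of `v ∘ w` in which the last letter is from `v`. -/
def circLeftWord (v w : Word) : AP K :=
  shuffleSum (fun l => Finsupp.single (toWord (l ++ [⟨true, Sep.prec⟩])) 1)
    (v.map fun s => ⟨true, s⟩) (letters false w)

/-- The part of `v ∘ w` in which the last letter is from `w`. -/
def circRightWord (v w : Word) : AP K :=
  shuffleSum (fun l => Finsupp.single (toWord (l ++ [⟨false, Sep.prec⟩])) 1)
    (letters true v) (w.map fun s => ⟨false, s⟩)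

theorem circWord_eq (v w : Word) :
    (circWord v w : AP K) = circLeftWord v w + circRightWord v w := by
  rw [circLeftWord, circRightWord, letters_eq, letters_eq,
    ← shuffleSum_concat_concat (fun l => (Finsupp.single (toWord l) 1 : AP K)), ← letters_eq,
    ← letters_eq]
  rfl

theorem op_single_P (s : Sep) (w : Word) :
    op s (Finsupp.single w 1 : AP K) P = Finsupp.single (w ++ [s]) 1 := by
  rw [P, op_single, mul_one]

theorem shuffleSum_concat_sep {T : Type*} (f : List T → Word) (s : Sep) (xs ys : List T) :
    shuffleSum (fun l => (Finsupp.single (f l ++ [s]) 1 : AP K)) xs ys =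
      op s (shuffleSum (fun l => Finsupp.single (f l) 1) xs ys) P := by
  have h := map_shuffleSum ((op (K := K) s).flip P).toAddMonoidHom
    (fun l : List T => (Finsupp.single (f l) 1 : AP K)) xs ys
  refine Eq.trans ?_ h.symm
  exact shuffleSum_congr (fun l => (op_single_P s (f l)).symm) _ _

theorem circLeftWord_nil (w : Word) :
    (circLeftWord [] w : AP K) = prec (Finsupp.single w 1) P := by
  rw [circLeftWord, List.map_nil, shuffleSum_nil_left, toWord_letters, prec_eq, op_single_P]
  rfl

theorem circRightWord_nil (v : Word) :
    (circRightWord v [] : AP K) = succ (Finsupp.single v 1) P := by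
  rw [circRightWord, List.map_nil, shuffleSum_nil_right, toWord_letters, succ_eq, op_single_P]
  rfl

/-- The last letter is from the first word. If the letter before it is too, they keep the symbol
`s`; if it is from the second word, they are joined by `≺`. -/
theorem circLeftWord_concat (v w : Word) (s : Sep) :
    (circLeftWord (v ++ [s]) w : AP K) =
      op s (circLeftWord v w) P + prec (circRightWord v w) P := by
  rw [circLeftWord, letters_eq, List.map_append, List.map_singleton, shuffleSum_concat_concat,
    ← letters_eq, prec_eq, circLeftWord, circRightWord, ← shuffleSum_concat_sep,
    ← shuffleSum_concat_sep, letters_eq true v]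
  congr 1
  · refine shuffleSum_congr (fun l => ?_) _ _
    rw [toWord_concat_concat, toWord_concat_sep l true s Sep.prec]
    rfl
  · simp only [toWord_concat_concat]
    exact shuffleSum_sep_left (fun z => (Finsupp.single (z ++ [Sep.prec]) 1 : AP K)) _ w s Sep.prec
      Sep.prec

theorem circRightWord_concat (v w : Word) (t : Sep) :
    (circRightWord v (w ++ [t]) : AP K) =
      op t (circRightWord v w) P + succ (circLeftWord v w) P := by
  rw [circRightWord, letters_eq, List.map_append, List.map_singleton, shuffleSum_concat_concat,
    ← letters_eq, succ_eq, circLeftWord, circRightWord, ← shuffleSum_concat_sep,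
    ← shuffleSum_concat_sep, letters_eq false w, add_comm]
  congr 1
  · refine shuffleSum_congr (fun l => ?_) _ _
    rw [toWord_concat_concat, toWord_concat_sep l false t Sep.prec]
    rfl
  · simp only [toWord_concat_concat]
    exact shuffleSum_sep_right (fun z => (Finsupp.single (z ++ [Sep.succ]) 1 : AP K)) _ v t Sep.prec
      Sep.prec

/-- The part of `α ∘ β` in which the last letter is from `α`. -/
def circLeft : AP K →ₗ[K] AP K →ₗ[K] AP K := bilin circLeftWord

/-- The part of `α ∘ β` in which the last letter is from `β`. -/
def circRight : AP K →ₗ[K] AP K →ₗ[K] AP K := bilin circRightWord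

theorem circ_eq_add (α β : AP K) : circ α β = circLeft α β + circRight α β := by
  simp only [circ_eq, circLeft, circRight, bilin_apply, circWord_eq, smul_add, Finsupp.sum_add]

theorem circLeft_P (β : AP K) : circLeft P β = prec β P := by
  rw [prec_eq]
  refine hom_ext (f := circLeft P) (g := (op Sep.prec).flip P) (fun w => ?_) β
  rw [P, circLeft, bilin_single, mul_one, one_smul, circLeftWord_nil, prec_eq]
  rfl

theorem circRight_P (α : AP K) : circRight α P = succ α P := by
  rw [succ_eq]
  refine hom_ext (f := circRight.flip P) (g := (op Sep.succ).flip P) (fun w => ?_) α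
  rw [LinearMap.flip_apply, P, circRight, bilin_single, mul_one, one_smul, circRightWord_nil,
    succ_eq]
  rfl

theorem circLeft_op_P (s : Sep) (α β : AP K) :
    circLeft (op s α P) β = op s (circLeft α β) P + prec (circRight α β) P := by
  rw [prec_eq]
  induction α using Finsupp.induction_linear with
  | zero => simp
  | add α α' h h' =>
    simp only [map_add, LinearMap.add_apply, h, h']
    abel
  | single v x =>
    induction β using Finsupp.induction_linear with
    | zero => simp
    | add β β' h h' =>
      simp only [map_add, LinearMap.add_apply, h, h']
      abel
    | single w y =>
      rw [P, op_single, mul_one, circLeft, circRight, bilin_single, bilin_single, bilin_single,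
        circLeftWord_concat, prec_eq, smul_add]
      simp only [map_smul, LinearMap.smul_apply, P]

theorem circRight_op_P (t : Sep) (α β : AP K) :
    circRight α (op t β P) = op t (circRight α β) P + succ (circLeft α β) P := by
  rw [succ_eq]
  induction α using Finsupp.induction_linear with
  | zero => simp
  | add α α' h h' =>
    simp only [map_add, LinearMap.add_apply, h, h']
    abel
  | single v x =>
    induction β using Finsupp.induction_linear with
    | zero => simp
    | add β β' h h' =>
      simp only [map_add, LinearMap.add_apply, h, h']
      abel
    | single w y =>
      rw [P, op_single, mul_one, circLeft, circRight, bilin_single, bilin_single, bilin_single,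
        circRightWord_concat, succ_eq, smul_add]
      simp only [map_smul, LinearMap.smul_apply, P]

/-! ### The main product with the powers `P_n` -/

/-- The mixed term of `circLeft_op_P` does not depend on the symbol `s`, so it drops out of the
difference `≻ - ≺`. -/
theorem circLeft_bullet_P (α β : AP K) :
    circLeft (bullet α P) β = bullet (circLeft α β) P := by
  simp only [bullet, prec_eq, succ_eq, map_sub, LinearMap.sub_apply, circLeft_op_P]
  abel

theorem circRight_bullet_P (α β : AP K) :
    circRight α (bullet β P) = bullet (circRight α β) P := by
  simp only [bullet, prec_eq, succ_eq, map_sub, circRight_op_P]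
  abel

theorem circLeft_Pn (β : AP K) {m : ℕ} (hm : 1 ≤ m) : circLeft (Pn m) β = prec β (Pn m) := by
  induction m, hm using Nat.le_induction with
  | base => rw [Pn_one, circLeft_P]
  | succ m hm ih => rw [Pn_succ hm, circLeft_bullet_P, ih, prec_bullet]

theorem circRight_Pn (α : AP K) {n : ℕ} (hn : 1 ≤ n) : circRight α (Pn n) = succ α (Pn n) := by
  induction n, hn using Nat.le_induction with
  | base => rw [Pn_one, circRight_P]
  | succ n hn ih => rw [Pn_succ hn, circRight_bullet_P, ih, succ_bullet]

theorem circ_Pn_Pn {m n : ℕ} (hm : 1 ≤ m) (hn : 1 ≤ n) :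
    (circ (Pn m) (Pn n) : AP K) = prec (Pn n) (Pn m) + succ (Pn m) (Pn n) := by
  rw [circ_eq_add, circLeft_Pn _ hm, circRight_Pn _ hn]

/-! ### The identity for `P_m ∘ P_n` -/

/-- Writing `P_{m+1} = P ≻ P_m - P ≺ P_m` moves one `P` into `C`, which raises `k` by one and
releases one summand `C ≻ P_m`. The case `k = 1` expands `P_n ≺ P_m`. -/
theorem prec_C_Pn (n : ℕ) {k m : ℕ} (hk : 1 ≤ k) (hm : 1 ≤ m) :
    -prec (C n k : AP K) (Pn m) =
      C n (k + m) + ∑ r ∈ Finset.Icc 1 (m - 1), succ (C n (m - r + k)) (Pn r) := by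
  induction m, hm using Nat.le_induction generalizing k with
  | base => simp [Pn_one, C_succ n hk]
  | succ m hm ih =>
    have h := ih (k := k + 1) (by omega)
    have hP : prec (C n k : AP K) (Pn (m + 1)) =
        -succ (C n (k + 1)) (Pn m) + prec (C n (k + 1)) (Pn m) := by
      rw [Pn_succ' hm, C_succ n hk, bullet, prec_sub_right, ← succ_prec, ← prec_assoc,
        prec_neg_left, succ_eq, succ_eq, map_neg, LinearMap.neg_apply]
      abel
    obtain ⟨j, rfl⟩ : ∃ j, m = j + 1 := ⟨m - 1, by omega⟩
    rw [hP, neg_add, neg_neg, h, add_tsub_cancel_right, add_tsub_cancel_right,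
      Finset.sum_Icc_succ_top (by omega)]
    have hs : ∑ r ∈ Finset.Icc 1 j, succ (C n (j + 1 - r + (k + 1)) : AP K) (Pn r) =
        ∑ r ∈ Finset.Icc 1 j, succ (C n (j + 1 + 1 - r + k)) (Pn r) :=
      Finset.sum_congr rfl fun r hr => by
        rw [Finset.mem_Icc] at hr
        rw [show j + 1 - r + (k + 1) = j + 1 + 1 - r + k by omega]
    rw [hs, show j + 1 + 1 - (j + 1) + k = k + 1 by omega,
      show k + 1 + (j + 1) = k + (j + 1 + 1) by omega]
    abel

/-- The mirror image: the last `P` of `P_{m+1}` is absorbed into `H`, and `k = 1` expands `P_m ≻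
P_n`. -/
theorem succ_Pn_H (n : ℕ) {k m : ℕ} (hk : 1 ≤ k) (hm : 1 ≤ m) :
    succ (Pn m) (H n k : AP K) =
      H n (k + m) - ∑ r ∈ Finset.Icc 1 (m - 1), prec (Pn r) (H n (m - r + k)) := by
  induction m, hm using Nat.le_induction generalizing k with
  | base => simp [Pn_one, H_succ n hk]
  | succ m hm ih =>
    have h := ih (k := k + 1) (by omega)
    have hP : succ (Pn (m + 1)) (H n k : AP K) =
        succ (Pn m) (H n (k + 1)) - prec (Pn m) (H n (k + 1)) := by
      rw [Pn_succ hm, H_succ n hk, bullet, succ_sub_left, succ_assoc, succ_prec]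
    obtain ⟨j, rfl⟩ : ∃ j, m = j + 1 := ⟨m - 1, by omega⟩
    rw [hP, h, add_tsub_cancel_right, add_tsub_cancel_right, Finset.sum_Icc_succ_top (by omega)]
    have hs : ∑ r ∈ Finset.Icc 1 j, prec (Pn r) (H n (j + 1 - r + (k + 1)) : AP K) =
        ∑ r ∈ Finset.Icc 1 j, prec (Pn r) (H n (j + 1 + 1 - r + k)) :=
      Finset.sum_congr rfl fun r hr => by
        rw [Finset.mem_Icc] at hr
        rw [show j + 1 - r + (k + 1) = j + 1 + 1 - r + k by omega]
    rw [hs, show j + 1 + 1 - (j + 1) + k = k + 1 by omega,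
      show k + 1 + (j + 1) = k + (j + 1 + 1) by omega]
    abel

theorem circ_Pn_Pn_eq {m n : ℕ} (hm : 1 ≤ m) (hn : 1 ≤ n) :
    circ (Pn m) (Pn n) = (C n (m + 1) + H n (m + 1) + ∑ r ∈ Finset.Icc 1 (m - 1),
      (hcross (C n (m - r)) (Pn r) + hcross (Pn r) (H n (m - r))) : AP K) := by
  have h1 := prec_C_Pn (K := K) n (k := 1) le_rfl hm
  have h2 := succ_Pn_H (K := K) n (k := 1) le_rfl hm
  rw [C_one, prec_neg_left, neg_neg] at h1
  rw [H_one] at h2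
  rw [circ_Pn_Pn hm hn, h1, h2, Finset.sum_add_distrib]
  have e1 : ∑ r ∈ Finset.Icc 1 (m - 1), hcross (C n (m - r) : AP K) (Pn r) =
      ∑ r ∈ Finset.Icc 1 (m - 1), succ (C n (m - r + 1)) (Pn r) :=
    Finset.sum_congr rfl fun r hr => by
      rw [Finset.mem_Icc] at hr
      rw [hcross, C_succ n (by omega), succ_eq, succ_eq, map_neg, LinearMap.neg_apply]
  have e2 : ∑ r ∈ Finset.Icc 1 (m - 1), hcross (Pn r) (H n (m - r) : AP K) =
      -∑ r ∈ Finset.Icc 1 (m - 1), prec (Pn r) (H n (m - r + 1)) := by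
    rw [← Finset.sum_neg_distrib]
    refine Finset.sum_congr rfl fun r hr => ?_
    rw [Finset.mem_Icc] at hr
    rw [hcross, H_succ n (by omega), succ_prec]
  rw [e1, e2, add_comm 1 m]
  abel

end AP

end

section

variable {K : Type u} {R₀ : Type v} [Field K] [Ring R₀] [Algebra K R₀]

open AP PsiDO

/-! ### Flows and the main product -/

section flow

variable {d : Deriv K R₀} {u : ℕ → R₀}

/-- The power `L^n` commutes with `L`, so the commutator can be expressed by its negative part. -/
theorem lax_eq_negPart {n : ℕ} {X : PsiDO d}
    (hX : X = nonnegPart (Lax d u ^ n) * Lax d u - Lax d u * nonnegPart (Lax d u ^ n)) :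
    X = Lax d u * negPart (Lax d u ^ n) - negPart (Lax d u ^ n) * Lax d u := by
  rw [hX, nonnegPart_eq, sub_mul, mul_sub, ← pow_succ, ← pow_succ']
  abel

theorem PsiDO.negPart_nonnegPart_mul (X Y : PsiDO d) :
    negPart (nonnegPart X * Y) = negPart (nonnegPart X * negPart Y) := by
  conv_lhs => rw [← nonnegPart_add_negPart Y]
  rw [mul_add, negPart_add, ((isNonneg_nonnegPart X).mul (isNonneg_nonnegPart Y)).negPart, zero_add]

theorem PsiDO.negPart_mul_negPart (X Y : PsiDO d) :
    negPart (X * negPart Y) = negPart (nonnegPart X * Y) + negPart X * negPart Y := by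
  have h : negPart (negPart X * negPart Y) = negPart X * negPart Y :=
    negPart_of_ordLE (((ordLE_negPart X).mul (ordLE_negPart Y)).mono (by omega))
  conv_lhs => rw [← nonnegPart_add_negPart X]
  rw [add_mul, negPart_add, h, negPart_nonnegPart_mul X Y]

variable {δ : Deriv K R₀} {n : ℕ}

/-- The last term is a recursion started at `-Z L`, where `Z = Y (L^n)_{<0} - δ Y - (Y L^n)_{<0}` is
exactly what makes the formula hold at `α = P`. Appending a letter then preserves the formula. -/
theorem ellFrom_circLeft_Pn (hδ : ∀ a, δ (d a) = d (δ a)) (hn : 1 ≤ n)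
    (hL : applyDeriv δ (Lax d u) =
      nonnegPart (Lax d u ^ n) * Lax d u - Lax d u * nonnegPart (Lax d u ^ n))
    (Y : PsiDO d) (α : AP K) :
    ellFrom d u (-Y * Lax d u) (circLeft α (Pn n)) =
      applyDeriv δ (ellFrom d u (-Y * Lax d u) α) -
        ellFrom d u (-Y * Lax d u) α * negPart (Lax d u ^ n) +
        ellFrom d u (-(Y * negPart (Lax d u ^ n) - applyDeriv δ Y - negPart (Y * Lax d u ^ n)) *
          Lax d u) α := by
  have hL' := lax_eq_negPart hL
  set L := Lax d u with hLdef
  set N := negPart (L ^ n) with hN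
  set Z := Y * N - applyDeriv δ Y - negPart (Y * L ^ n) with hZ
  refine hom_ext (f := (ellFrom d u (-Y * L)).comp (circLeft.flip (Pn n)))
    (g := (applyDerivHom d δ).comp (ellFrom d u (-Y * L)) -
      (LinearMap.mulRight K N).comp (ellFrom d u (-Y * L)) + ellFrom d u (-Z * L))
    (fun w => ?_) α
  simp only [LinearMap.comp_apply, LinearMap.flip_apply, LinearMap.add_apply, LinearMap.sub_apply,
    LinearMap.mulRight_apply]
  show _ = applyDeriv δ _ - _ + _
  induction w using List.reverseRecOn with
  | nil =>
    rw [show (Finsupp.single [] 1 : AP K) = P from rfl, circLeft_P, ellFrom_prec, ellFrom_P,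
      ellFrom_P, hLdef, ellFrom_mul_Lax_Pn d u _ hn, ← hLdef, applyDeriv_mul hδ, hL', hZ,
      applyDeriv_neg, ellFrom_P, neg_mul Y (L ^ n), PsiDO.negPart_neg]
    noncomm_ring
  | append_singleton w s ih =>
    rw [← op_single_P, circLeft_op_P, map_add, circRight_Pn _ hn, ellFrom_prec, ellFrom_P,
      ellFrom_succ, hLdef, ellFrom_mul_Lax_Pn d u _ hn, ← hLdef]
    -- With `E` the operator of the shorter word, `(E N)_{<0}` contains `(E_{≥0} L^n)_{<0}`, which
    -- cancels the contribution of `(w ≻ P_n) ≺ P`.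
    have hE := negPart_mul_negPart (ellFrom d u (-Y * L) (Finsupp.single w 1)) (L ^ n)
    rw [← hN] at hE
    cases s with
    | prec =>
      rw [← prec_eq, ← prec_eq, ellFrom_prec, ellFrom_prec, ellFrom_prec, ellFrom_P, ellFrom_P,
        ellFrom_P, ← hLdef, ih, negPart_add, negPart_sub, hE, applyDeriv_mul hδ, applyDeriv_neg,
        applyDeriv_negPart, hL']
      noncomm_ring
    | succ =>
      rw [← succ_eq, ← succ_eq, ellFrom_succ, ellFrom_succ, ellFrom_succ, ellFrom_P, ellFrom_P,
        ellFrom_P, ← hLdef, ih, nonnegPart_eq (_ + _), negPart_add, negPart_sub, hE,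
        applyDeriv_mul hδ, applyDeriv_nonnegPart, hL']
      simp only [nonnegPart_eq]
      noncomm_ring

theorem res_ellFrom_circ_Pn (hδ : ∀ a, δ (d a) = d (δ a)) (hn : 1 ≤ n)
    (hL : applyDeriv δ (Lax d u) =
      nonnegPart (Lax d u ^ n) * Lax d u - Lax d u * nonnegPart (Lax d u ^ n))
    (Y : PsiDO d) (α : AP K) :
    res (ellFrom d u (-Y * Lax d u) (circ α (Pn n))) =
      δ (res (ellFrom d u (-Y * Lax d u) α)) +
        res (ellFrom d u (-(Y * negPart (Lax d u ^ n) - applyDeriv δ Y - negPart (Y * Lax d u ^ n)) *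
          Lax d u) α) := by
  rw [circ_eq_add, map_add, circRight_Pn _ hn, ellFrom_succ, ellFrom_mul_Lax_Pn d u _ hn,
    ellFrom_circLeft_Pn hδ hn hL]
  set E := ellFrom d u (-Y * Lax d u) α
  -- The right side is the contribution of `α ≻ P_n`, so it cancels the middle term of
  -- `ellFrom_circLeft_Pn`.
  have h : res (E * negPart (Lax d u ^ n)) = res (nonnegPart E * Lax d u ^ n) := by
    rw [← res_negPart, negPart_mul_negPart, res_add, res_negPart,
      ((ordLE_negPart E).mul (ordLE_negPart (Lax d u ^ n))).res (by omega), add_zero]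
  rw [res_add, res_add, res_sub, h, res_applyDeriv]
  abel

theorem Phi_circ_Pn (hδ : ∀ a, δ (d a) = d (δ a)) (hn : 1 ≤ n)
    (hL : applyDeriv δ (Lax d u) =
      nonnegPart (Lax d u ^ n) * Lax d u - Lax d u * nonnegPart (Lax d u ^ n))
    (α : AP K) : Phi d u (circ α (Pn n)) = δ (Phi d u α) := by
  -- For `Y = -1` the recursion starts at `L`, and the two projections of `L^n` in the correction
  -- cancel.
  have h := res_ellFrom_circ_Pn hδ hn hL (-1) α
  have hZ : -1 * negPart (Lax d u ^ n) - applyDeriv δ (-1) - negPart (-1 * Lax d u ^ n) = 0 := by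
    rw [applyDeriv_neg, applyDeriv_one, neg_one_mul, neg_one_mul, PsiDO.negPart_neg]
    abel
  rw [hZ, neg_neg, one_mul, neg_zero, zero_mul, ellFrom_zero] at h
  rw [Phi, ell_eq, h]
  exact add_zero _

end flow

/-! ### The elements `U` -/

section potentials

variable (d : Deriv K R₀) (u : ℕ → R₀)

theorem applyDeriv_self_Lax : applyDeriv d (Lax d u) =
    nonnegPart (Lax d u ^ 1) * Lax d u - Lax d u * nonnegPart (Lax d u ^ 1) := by
  rw [pow_one, nonnegPart_Lax, applyDeriv_self]

/-- Each further factor `P = P_1` is handled by the flow formula for `d`, since `d L = [∂, L]` is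
its Lax equation. The correction replaces `Y`, so the induction must run over all `Y` of negative
order. -/
theorem res_ellFrom_circ_pow {Y : PsiDO d} (hY : OrdLE Y (-1)) (k : ℕ) :
    res (ellFrom d u (-Y * Lax d u) (opPow circ P (k + 1) : AP K)) =
      (-1 : K) ^ (k + 1) • Y.coeff (-(k + 2 : ℕ)) := by
  have hYN : OrdLE (Y * negPart (Lax d u)) (-2) := hY.mul (ordLE_negPart _)
  have hYL : Y * Lax d u = Y * partialOp d + Y * negPart (Lax d u) := by
    rw [← nonnegPart_Lax d u, ← mul_add, nonnegPart_add_negPart]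
  induction k generalizing Y with
  | zero =>
    rw [zero_add, opPow_one, ellFrom_P, neg_mul, res_neg, hYL, res_add, hYN.res le_rfl, add_zero,
      res, coeff_mul_partialOp]
    simp
  | succ k ih =>
    have hZ : Y * negPart (Lax d u ^ 1) - applyDeriv d Y - negPart (Y * Lax d u ^ 1) =
        -(applyDeriv d Y + negPart (Y * partialOp d)) := by
      rw [pow_one, hYL, negPart_add, negPart_of_ordLE (hYN.mono (by omega))]
      abel
    have hZ1 : OrdLE (-(applyDeriv d Y + negPart (Y * partialOp d))) (-1) :=
      ((hY.applyDeriv d).add (ordLE_negPart _)).neg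
    have h := res_ellFrom_circ_Pn (fun _ => rfl) le_rfl (applyDeriv_self_Lax d u) Y
      (opPow circ P (k + 1) : AP K)
    rw [Pn_one, hZ, ih hY hYN hYL, ih hZ1 (hZ1.mul (ordLE_negPart _))
      (by rw [← nonnegPart_Lax d u, ← mul_add, nonnegPart_add_negPart]), map_smul] at h
    -- The derivative of the residue cancels against `d Y` in the correction. What remains is `-(Y
    -- ∂)_{<0}`, whose coefficients are those of `Y` shifted by one.
    rw [opPow_succ _ _ (by omega), h, coeff_neg, coeff_add, coeff_applyDeriv, coeff_negPart,
      if_pos (by omega), coeff_mul_partialOp, neg_add, smul_add, smul_neg, smul_neg,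
      add_neg_cancel_left, pow_succ _ (k + 1), mul_neg_one, neg_smul]
    congr 3

theorem Phi_U {n : ℕ} (hn : 2 ≤ n) : Phi d u (U n : AP K) = u n := by
  rw [U]
  split_ifs with h
  · subst h
    rw [Phi, ell_eq, ellFrom_P]
    rfl
  · obtain ⟨k, rfl⟩ : ∃ k, n = k + 3 := ⟨n - 3, by omega⟩
    rw [Phi, map_smul, ell_eq, ellFrom_prec, ellFrom_P, show k + 3 - 2 = k + 1 by omega]
    show (-1 : K) ^ (k + 3) • res (d := d) _ = _
    rw [res_ellFrom_circ_pow d u (ordLE_negPart _), smul_smul, ← pow_add, coeff_negPart,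
      if_pos (by omega), coeff_Lax, if_neg (by omega), if_pos (by omega)]
    rw [Even.neg_one_pow ⟨k + 2, by omega⟩, one_smul]
    congr 1

end potentials

/-! ### Solutions of the hierarchy -/

section hierarchy

variable {d : Deriv K R₀}

/-- The two commutators differ by `[X, Y]`, `[X_{≥0}, Y_{≥0}]` and `[X_{<0}, Y_{<0}]` up to sign.
The first is zero and the others have no residue. This gives `∂_{t_m} ∂_{t_n} φ = ∂_{t_n} ∂_{t_m} φ`
without commutativity of the flows. -/
theorem PsiDO.res_commutator_comm {X Y : PsiDO d} (h : X * Y = Y * X) :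
    res (nonnegPart X * Y - Y * nonnegPart X) = res (nonnegPart Y * X - X * nonnegPart Y) := by
  have h1 := ((isNonneg_nonnegPart X).mul (isNonneg_nonnegPart Y)).res
  have h2 := ((isNonneg_nonnegPart Y).mul (isNonneg_nonnegPart X)).res
  have h3 := ((ordLE_negPart X).mul (ordLE_negPart Y)).res (by omega)
  have h4 := ((ordLE_negPart Y).mul (ordLE_negPart X)).res (by omega)
  have h5 : nonnegPart X * Y - Y * nonnegPart X - (nonnegPart Y * X - X * nonnegPart Y) =
      (X * Y - Y * X) + (nonnegPart X * nonnegPart Y - nonnegPart Y * nonnegPart X) -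
        (negPart X * negPart Y - negPart Y * negPart X) := by
    simp only [nonnegPart_eq]
    noncomm_ring
  rw [← sub_eq_zero, ← res_sub, h5, h, sub_self, zero_add, res_sub, res_sub, res_sub, h1, h2, h3, h4]
  simp

theorem applyDeriv_pow {δ : Deriv K R₀} (hδ : ∀ a, δ (d a) = d (δ a)) {A X : PsiDO d}
    (h : applyDeriv δ X = A * X - X * A) (m : ℕ) :
    applyDeriv δ (X ^ m) = A * X ^ m - X ^ m * A := by
  induction m with
  | zero => rw [pow_zero, applyDeriv_one, mul_one, one_mul, sub_self]
  | succ m ih =>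
    rw [pow_succ, applyDeriv_mul hδ, ih, h]
    noncomm_ring

variable {u : ℕ → R₀} {φ : R₀} {dt : ℕ → Deriv K R₀}

theorem IsNcKP.lax_pow (h : IsNcKP d u φ dt) {n : ℕ} (hn : 1 ≤ n) :
    applyDeriv (dt n) (Lax d u) =
      nonnegPart (Lax d u ^ n) * Lax d u - Lax d u * nonnegPart (Lax d u ^ n) := by
  rw [h.lax n hn, pow_eq]

theorem IsNcKP.res_pow (h : IsNcKP d u φ dt) {n : ℕ} (hn : 1 ≤ n) :
    dt n φ = res (Lax d u ^ n) := by
  rw [h.potential_flow n hn, pow_eq]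

theorem IsNcKP.Phi_Pn (h : IsNcKP d u φ dt) {n : ℕ} (hn : 1 ≤ n) :
    Phi d u (Pn n : AP K) = dt n φ := by
  rw [Phi, ell_Pn d u hn, h.res_pow hn]

theorem IsNcKP.dt_dt (h : IsNcKP d u φ dt) {m n : ℕ} (hm : 1 ≤ m) (hn : 1 ≤ n) :
    dt m (dt n φ) = dt n (dt m φ) := by
  rw [h.res_pow hn, h.res_pow hm, ← res_applyDeriv, ← res_applyDeriv,
    applyDeriv_pow (h.dt_comm m hm) (h.lax_pow hm), applyDeriv_pow (h.dt_comm n hn) (h.lax_pow hn)]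
  exact res_commutator_comm (by rw [← pow_add, ← pow_add, add_comm])

theorem IsNcKP.Phi_circ_Pn_Pn (h : IsNcKP d u φ dt) {m n : ℕ} (hm : 1 ≤ m) (hn : 1 ≤ n) :
    Phi d u (circ (Pn m) (Pn n) : AP K) = dt m (dt n φ) := by
  rw [Phi_circ_Pn (h.dt_comm n hn) hn (h.lax_pow hn), h.Phi_Pn hm, h.dt_dt hm hn]

theorem Phi_add (α β : AP K) : Phi d u (α + β) = Phi d u α + Phi d u β :=
  map_add ((resHom d).comp (ell d u)) α β

theorem Phi_sum {ι : Type*} (s : Finset ι) (f : ι → AP K) :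
    Phi d u (∑ i ∈ s, f i) = ∑ i ∈ s, Phi d u (f i) :=
  map_sum ((resHom d).comp (ell d u)) f s

end hierarchy

/-! ### The generic solution -/

theorem Deriv.map_algebraMap (δ : Deriv K R₀) (c : K) : δ (algebraMap K R₀ c) = 0 := by
  rw [Algebra.algebraMap_eq_smul_one, map_smul, δ.map_one, smul_zero]

section generic

variable {T : Type*}

theorem freeDeriv_ι (f : T → FreeAlgebra K T) (t : T) :
    freeDeriv f (FreeAlgebra.ι K t) = f t := by
  show (FreeAlgebra.lift K _ (FreeAlgebra.ι K t) : TrivSqZeroExt _ _).snd = f t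
  simp

theorem Deriv.eq_of_forall_ι {δ δ' : Deriv K (FreeAlgebra K T)}
    (h : ∀ t, δ (FreeAlgebra.ι K t) = δ' (FreeAlgebra.ι K t)) (a : FreeAlgebra K T) :
    δ a = δ' a := by
  induction a using FreeAlgebra.induction with
  | grade0 r => rw [δ.map_algebraMap, δ'.map_algebraMap]
  | grade1 t => exact h t
  | mul a b ha hb => rw [δ.map_mul, δ'.map_mul, ha, hb]
  | add a b ha hb => rw [map_add, map_add, ha, hb]

theorem Deriv.comm_of_forall_ι {δ δ' : Deriv K (FreeAlgebra K T)}
    (h : ∀ t, δ (δ' (FreeAlgebra.ι K t)) = δ' (δ (FreeAlgebra.ι K t))) (a : FreeAlgebra K T) :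
    δ (δ' a) = δ' (δ a) := by
  induction a using FreeAlgebra.induction with
  | grade0 r => rw [δ.map_algebraMap, δ'.map_algebraMap, map_zero, map_zero]
  | grade1 t => exact h t
  | mul a b ha hb =>
    rw [δ.map_mul, δ'.map_mul, map_add, map_add, δ.map_mul, δ.map_mul, δ'.map_mul, δ'.map_mul,
      ha, hb]
    abel
  | add a b ha hb => simp only [map_add, ha, hb]

theorem genD_ι (p : ℕ × ℕ) : genD K (FreeAlgebra.ι K p) = FreeAlgebra.ι K (p.1, p.2 + 1) :=
  freeDeriv_ι _ p

theorem iterate_genD_ι (i j s : ℕ) :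
    (genD K)^[s] (FreeAlgebra.ι K (i, j)) = FreeAlgebra.ι K (i, j + s) := by
  induction s with
  | zero => rfl
  | succ s ih => rw [Function.iterate_succ_apply', ih, genD_ι, add_assoc]

/-- The image of the generator `(i, 0)` under the flow `δₙ`. -/
theorem genFlow_ι (n : ℕ) (p : ℕ × ℕ) : genFlow K n (FreeAlgebra.ι K p) =
    (genD K)^[p.2] (if p.1 = 0 then res (Lax (genD K) (genU K) ^ n)
      else (nonnegPart (Lax (genD K) (genU K) ^ n) * Lax (genD K) (genU K) -
        Lax (genD K) (genU K) * nonnegPart (Lax (genD K) (genU K) ^ n)).coeff (-(p.1 + 1 : ℤ))) := by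
  simp only [← pow_eq]
  exact freeDeriv_ι _ p

theorem genFlow_comm (n : ℕ) (a : FreeAlgebra K (ℕ × ℕ)) :
    genFlow K n (genD K a) = genD K (genFlow K n a) :=
  Deriv.comm_of_forall_ι (fun p => by
    rw [genD_ι, genFlow_ι, genFlow_ι, Function.iterate_succ_apply']) a

theorem genFlow_genPhi (n : ℕ) : genFlow K n (genPhi K) = res (Lax (genD K) (genU K) ^ n) :=
  genFlow_ι n (0, 0)

theorem genU_two : genU K 2 = genD K (genPhi K) := if_pos rfl

theorem genU_add_three (i : ℕ) : genU K (i + 3) = FreeAlgebra.ι K (i + 1, 0) := if_neg (by omega)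

theorem genFlow_one (a : FreeAlgebra K (ℕ × ℕ)) : genFlow K 1 a = genD K a := by
  refine Deriv.eq_of_forall_ι (fun p => ?_) a
  obtain ⟨i, j⟩ := p
  rw [genFlow_ι, genD_ι, pow_one, nonnegPart_Lax, ← applyDeriv_self, coeff_applyDeriv]
  cases i with
  | zero =>
    rw [if_pos rfl]
    have h : res (Lax (genD K) (genU K)) = FreeAlgebra.ι K (0, 1) :=
      genU_two.trans (genD_ι (0, 0))
    rw [h, iterate_genD_ι, add_comm]
  | succ i =>
    rw [if_neg (by simp), coeff_Lax, if_neg (by push_cast; omega), if_pos (by push_cast; omega),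
      show (-(-(((i + 1 : ℕ) : ℤ) + 1))).toNat + 1 = i + 3 by omega, genU_add_three, genD_ι,
      iterate_genD_ι]
    simp only [zero_add, add_comm]

theorem isNcKP_generic : IsNcKP (genD K) (genU K) (genPhi K) (genFlow K) where
  dt_one := genFlow_one
  dt_comm n _ := genFlow_comm n
  lax n hn := by
    rw [pow_eq]
    ext k
    rw [coeff_applyDeriv, coeff_Lax]
    have hneg := lax_eq_negPart (d := genD K) (u := genU K) (n := n) rfl
    set L := Lax (genD K) (genU K) with hL
    have hdec : L = partialOp (genD K) + negPart L := by
      rw [← nonnegPart_Lax (genD K) (genU K), nonnegPart_add_negPart]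
    -- Splitting `L = ∂ + L_{<0}` leaves `d` applied to the coefficients of `(L^n)_{<0}`, up to
    -- terms of order at most `-2`.
    have hcomm : L * negPart (L ^ n) - negPart (L ^ n) * L =
        applyDeriv (genD K) (negPart (L ^ n)) +
          (negPart L * negPart (L ^ n) - negPart (L ^ n) * negPart L) := by
      have h : ∀ A B N : PsiDO (genD K), (A + B) * N - N * (A + B) =
          A * N - N * A + (B * N - N * B) := fun A B N => by noncomm_ring
      rw [applyDeriv_self, ← h, ← hdec]
    have hlow : OrdLE (negPart L * negPart (L ^ n) - negPart (L ^ n) * negPart L) (-2) :=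
      ((ordLE_negPart _).mul (ordLE_negPart _)).sub ((ordLE_negPart _).mul (ordLE_negPart _))
    rcases lt_or_ge k 0 with hk | hk
    · rw [if_neg (by omega), if_pos hk]
      obtain ⟨i, rfl⟩ : ∃ i : ℕ, k = -(i + 1 : ℤ) := ⟨(-k).toNat - 1, by omega⟩
      cases i with
      | zero =>
        -- The coefficient of `∂⁻¹` is `d (res L^n) = d (δ_n φ) = δ_n u_2`. The lower coefficients
        -- agree by the definition of `δ_n`.
        rw [hneg, hcomm]
        have h2 : (-(-(((0 : ℕ) : ℤ) + 1))).toNat + 1 = 2 := rfl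
        rw [h2, genU_two, genFlow_comm, genFlow_genPhi, coeff_add, hlow _ (by simp), add_zero,
          coeff_applyDeriv, coeff_negPart, if_pos (by simp)]
        rfl
      | succ i =>
        rw [show (-(-(((i + 1 : ℕ) : ℤ) + 1))).toNat + 1 = i + 3 by omega, genU_add_three,
          genFlow_ι]
        rw [if_neg (by simp)]
        rfl
    -- The commutator has negative order, while the non-negative coefficients of `L` are the
    -- constants 0 and 1, which every derivation kills.
    · rw [hneg]
      have h0 : ∀ k, 0 ≤ k →
          (L * negPart (L ^ n) - negPart (L ^ n) * L).coeff k = 0 := by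
        intro k hk
        rw [hcomm, coeff_add, hlow k (by omega), add_zero, coeff_applyDeriv, coeff_negPart,
          if_neg (by omega), map_zero]
      rw [h0 k hk]
      split_ifs
      · exact Deriv.map_one _
      · omega
      · exact map_zero _
  potential := genU_two
  potential_flow n _ := by rw [pow_eq, genFlow_genPhi]

end generic

end

end NCKP

end

theorem theorem7p1 {K : Type*} [Field K] [CharZero K]
    {R₀ : Type*} [Ring R₀] [Algebra K R₀] (d : Deriv K R₀) (u : ℕ → R₀) :
    -- the Lax operator is invertible
    PsiDO.IsInverse (Lax d u) (PsiDO.inverse (Lax d u)) ∧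
    -- the images of `U_n`
    (∀ n ≥ 2, Phi d u (AP.U n) = u n) ∧
    -- the coefficients `σ⁽ᵐ⁾_n` exist, are unique, and are the images of `C⁽ᵐ⁾_n`
    (∀ m ≥ 1, ∀ s : ℕ → R₀, IsSigma d u m s ↔ ∀ n ≥ 1, s n = Phi d u (AP.C m n)) ∧
    -- the coefficients `η⁽ᵐ⁾_n` exist, are unique, and are the images of `H⁽ᵐ⁾_n`
    (∀ m ≥ 1, ∀ s : ℕ → R₀, IsEta d u m s ↔ ∀ n ≥ 1, s n = Phi d u (AP.H m n)) ∧
    -- the identity for `P_m ∘ P_n` in `A(P)`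
    (∀ m ≥ 1, ∀ n ≥ 1, AP.circ (AP.Pn m) (AP.Pn n) =
      (AP.C n (m + 1) + AP.H n (m + 1) + ∑ r ∈ Finset.Icc 1 (m - 1),
        (AP.hcross (AP.C n (m - r)) (AP.Pn r) + AP.hcross (AP.Pn r) (AP.H n (m - r))) : AP K)) ∧
    -- its image under `Φ` on solutions of the hierarchy, term by term and as an equation
    (∀ (φ : R₀) (dt : ℕ → Deriv K R₀), IsNcKP d u φ dt →
      ∀ σ η : ℕ → ℕ → R₀, (∀ n ≥ 1, IsSigma d u n (σ n)) → (∀ n ≥ 1, IsEta d u n (η n)) →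
        ∀ m ≥ 1, ∀ n ≥ 1,
          Phi d u (AP.Pn n) = dt n φ ∧
          Phi d u (AP.circ (AP.Pn m) (AP.Pn n)) = dt m (dt n φ) ∧
          Phi d u (AP.C n (m + 1)) = σ n (m + 1) ∧
          Phi d u (AP.H n (m + 1)) = η n (m + 1) ∧
          (∀ r ∈ Finset.Icc 1 (m - 1),
            Phi d u (AP.hcross (AP.C n (m - r)) (AP.Pn r)) = σ n (m - r) * dt r φ ∧
            Phi d u (AP.hcross (AP.Pn r) (AP.H n (m - r))) = dt r φ * η n (m - r)) ∧
          dt m (dt n φ) = σ n (m + 1) + η n (m + 1) +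
            ∑ r ∈ Finset.Icc 1 (m - 1), (σ n (m - r) * dt r φ + dt r φ * η n (m - r))) ∧
    -- the generic operator with the flows `δ_n` is a solution of the hierarchy
    IsNcKP (genD K) (genU K) (genPhi K) (genFlow K) := by
  refine ⟨isInverse_Lax d u, fun n hn => Phi_U d u hn, fun m hm s => ?_, fun m hm s => ?_,
    fun m hm n hn => AP.circ_Pn_Pn_eq hm hn, fun φ dt h σ η hσ hη m hm n hn => ?_, isNcKP_generic⟩
  · exact ⟨fun hs => isSigma_unique d u hs (isSigma_Phi_C d u hm),
      fun hs => (isSigma_Phi_C d u hm).congr d u hs⟩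
  · exact ⟨fun hs => isEta_unique d u hs (isEta_Phi_H d u hm),
      fun hs => (isEta_Phi_H d u hm).congr d u hs⟩
  · have hC : ∀ k ≥ 1, Phi d u (AP.C n k : AP K) = σ n k := fun k hk =>
      isSigma_unique d u (isSigma_Phi_C d u hn) (hσ n hn) k hk
    have hH : ∀ k ≥ 1, Phi d u (AP.H n k : AP K) = η n k := fun k hk =>
      isEta_unique d u (isEta_Phi_H d u hn) (hη n hn) k hk
    have hr : ∀ r ∈ Finset.Icc 1 (m - 1),
        Phi d u (AP.hcross (AP.C n (m - r)) (AP.Pn r) : AP K) = σ n (m - r) * dt r φ ∧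
          Phi d u (AP.hcross (AP.Pn r) (AP.H n (m - r)) : AP K) = dt r φ * η n (m - r) := by
      intro r hr
      rw [Finset.mem_Icc] at hr
      rw [Phi_hcross, Phi_hcross, hC _ (by omega), hH _ (by omega), h.Phi_Pn hr.1]
      exact ⟨rfl, rfl⟩
    refine ⟨h.Phi_Pn hn, h.Phi_circ_Pn_Pn hm hn, hC _ (by omega), hH _ (by omega), hr, ?_⟩
    -- The equation for `φ` is obtained by applying `Φ` to the identity in `A(P)`.
    rw [← h.Phi_circ_Pn_Pn hm hn, AP.circ_Pn_Pn_eq hm hn, Phi_add, Phi_add, hC _ (by omega),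
      hH _ (by omega), Phi_sum]
    refine congrArg _ (Finset.sum_congr rfl fun r hr' => ?_)
    rw [Phi_add, (hr r hr').1, (hr r hr').2]
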